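/- Let $\tau>0$ be a fixed known constant. Let $(W_t)$ be a standard Brownian motion and, for each $n$, let $\epsilon_{1,n},\dots,\epsilon_{n,n}$ be i.i.d. $\mathcal N(0,1)$ random variables independent of $W$. For a positive continuous deterministic function $\sigma$ on $[0,1]$ let $X_t=\int_0^t\sigma(s)\,dW_s$ (with continuous paths), and suppose that one observes $$\bar Y_{i,n}=\int_0^{i/n}X_s\,ds+\tau\,\epsilon_{i,n},\qquad i=1,\dots,n .$$ For $\alpha>0$, $L>0$, $0<l<u<\infty$ and $p=[\alpha]$ (the integer part of $\alpha$), let $\mathcal C^b(\alpha,L)=\mathcal C^b(\alpha,L,[l,u])$ be the set of functions $f$ on $[0,1]$ such that $f^{(p)}$ exists on $[0,1]$, $|f^{(p)}(x)-f^{(p)}(y)|\le L|x-y|^{\alpha-p}$ for all $x,y\in[0,1]$, and $l\le f\le u$. Write $\|\cdot\|_2$ for the norm of $L_2[0,1]$. **Theorem.** (i) Let $\alpha>1/2$, $L>0$ and $0<l<u<\infty$. There is a constant $C>0$, depending only on $\alpha,L,l,u$ (and on the fixed noise level $\tau$), such that $$\liminf_{n\to\infty}\ \inf_{\hat\sigma^2_n}\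 \sup_{\sigma^2\in\mathcal C^b(\alpha,L)}\ \mathrm E\Big(n^{\frac{\alpha}{4\alpha+2}}\,\|\hat\sigma^2_n-\sigma^2\|_2^2\Big)\ \ge\ C,$$ where the infimum is over all estimators, i.e. all (measurable) functions of $(\bar Y_{1,n},\dots,\bar Y_{n,n})$ with values in the functions on $[0,1]$. So the minimax rate in $L_2$-norm is no better than $n^{-\alpha/(8\alpha+4)}$. (ii) Let $0<\sigma_{\min}<\sigma_{\max}<\infty$. There is a constant $\tilde C>0$, depending only on $\sigma_{\min},\sigma_{\max}$ (and on the fixed noise level $\tau$), such that, when $\sigma$ is constant, $$\liminf_{n\to\infty}\ \inf_{\hat\sigma^2_n}\ \sup_{\sigma^2\in[\sigma_{\min},\sigma_{\max}]}\ \mathrm E\Big(n^{1/4}\,(\hat\sigma^2_n-\sigma^2)^2\Big)\ \ge\ \tilde C,$$ where the infimum is over all real-valued (measurable) functions of $(\bar Y_{1,n},\dots,\bar Y_{n,n})$. So the rate is no better than $n^{-1/8}$. -/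

import Mathlib

open MeasureTheory ProbabilityTheory Filter Set
open scoped ENNReal NNReal Topology

/-- The class of uniformly bounded Hölder functions of index `α` on `[0,1]`: with `p = [α]` the
integer part of `α`, the `p`-th derivative of `f` exists on `[0,1]` (one-sided at the end points),
it satisfies `|f^(p) x - f^(p) y| ≤ L |x - y|^(α - p)`, and `l ≤ f ≤ u` on `[0,1]`. The values of
`f` outside `[0,1]` play no role. -/
def holderClass (α L l u : ℝ) : Set (ℝ → ℝ) :=
  {f | (∀ k < ⌊α⌋₊,
          DifferentiableOn ℝ (iteratedDerivWithin k f (Icc 0 1)) (Icc 0 1)) ∧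
       (∀ x ∈ Icc (0 : ℝ) 1, ∀ y ∈ Icc (0 : ℝ) 1,
          |iteratedDerivWithin ⌊α⌋₊ f (Icc 0 1) x - iteratedDerivWithin ⌊α⌋₊ f (Icc 0 1) y|
            ≤ L * |x - y| ^ (α - (⌊α⌋₊ : ℝ))) ∧
       (∀ x ∈ Icc (0 : ℝ) 1, l ≤ f x ∧ f x ≤ u)}

/-- The step function `∑_{k < m} c k · 1_{(s k, s (k+1)]}` on the real line. -/
noncomputable def stepFunction (m : ℕ) (s : ℕ → ℝ≥0) (c : ℕ → ℝ) (r : ℝ) : ℝ :=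
  ∑ k ∈ Finset.range m, (Ioc (s k : ℝ) (s (k + 1) : ℝ)).indicator (fun _ => c k) r

/-- The integral `∑_{k < m} c k · (W_{s (k+1)} - W_{s k})` of a step function against `W`. -/
def stepIntegral {Ω : Type*} (W : ℝ≥0 → Ω → ℝ) (m : ℕ) (s : ℕ → ℝ≥0) (c : ℕ → ℝ) (ω : Ω) : ℝ :=
  ∑ k ∈ Finset.range m, c k * (W (s (k + 1)) ω - W (s k) ω)

/-- `Z` is (a version of) the Wiener integral `∫_0^t f dW` of the deterministic function
`f ∈ L²(0,t)`: there are step functions `g` on `(0,t]` which are simultaneously arbitrarily close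
to `f` in `L²(0,t)` and have `∫ g dW` arbitrarily close to `Z` in `L²(P)`. -/
def IsWienerIntegral {Ω : Type*} [MeasurableSpace Ω] (P : Measure Ω) (W : ℝ≥0 → Ω → ℝ)
    (f : ℝ → ℝ) (t : ℝ≥0) (Z : Ω → ℝ) : Prop :=
  MemLp f 2 (volume.restrict (Ioc (0 : ℝ) t)) ∧ MemLp Z 2 P ∧
  ∀ δ : ℝ≥0∞, 0 < δ → ∃ (m : ℕ) (s : ℕ → ℝ≥0) (c : ℕ → ℝ), Monotone s ∧ (∀ k, s k ≤ t) ∧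
    eLpNorm (fun r => f r - stepFunction m s c r) 2 (volume.restrict (Ioc (0 : ℝ) t)) ≤ δ ∧
    eLpNorm (fun ω => Z ω - stepIntegral W m s c ω) 2 P ≤ δ

/-- `X` is (a version with almost surely continuous paths of) the process
`X_t = ∫_0^t σ(s) dW_s`, `t ∈ [0,1]`. -/
structure IsWienerIntegralProcess {Ω : Type*} [MeasurableSpace Ω] (P : Measure Ω)
    (W : ℝ≥0 → Ω → ℝ) (σ : ℝ → ℝ) (X : ℝ≥0 → Ω → ℝ) : Prop where
  isWienerIntegral : ∀ t ≤ 1, IsWienerIntegral P W σ t (X t)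
  continuousOn : ∀ᵐ ω ∂P, ContinuousOn (fun t => X t ω) (Icc 0 1)

/-- The random elements of the model: a standard Brownian motion `W`, for each `n` a vector
`ε n = (ε_{1,n}, …, ε_{n,n})` of i.i.d. standard normal variables independent of `W` and, for each
positive continuous deterministic volatility `σ` on `[0,1]`, the process
`X σ = (∫_0^t σ(s) dW_s)_{t ∈ [0,1]}`. -/
structure IsNoisyVolatilityModel {Ω : Type*} [MeasurableSpace Ω] (P : Measure Ω)
    (W : ℝ≥0 → Ω → ℝ) (ε : (n : ℕ) → Fin n → Ω → ℝ) (X : (ℝ → ℝ) → ℝ≥0 → Ω → ℝ) : Prop where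
  brownian : IsBrownianReal W P
  noise_law : ∀ n i, HasLaw (ε n i) (gaussianReal 0 1) P
  noise_indep : ∀ n, iIndepFun (ε n) P
  indep : ∀ n, IndepFun (fun ω t => W t ω) (fun ω i => ε n i ω) P
  process : ∀ σ : ℝ → ℝ, ContinuousOn σ (Icc 0 1) → (∀ s ∈ Icc (0 : ℝ) 1, 0 < σ s) →
    IsWienerIntegralProcess P W σ (X σ)

/-- The observation vector `(∫_0^{i/n} X_s ds + τ ε_{i,n})_{i = 1, …, n}`. The index `i : Fin n`
stands for the one-based index `i + 1`. -/
noncomputable def integratedObservation {Ω : Type*} (τ : ℝ) (n : ℕ) (X : ℝ≥0 → Ω → ℝ)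
    (ε : Fin n → Ω → ℝ) (ω : Ω) : Fin n → ℝ :=
  fun i => (∫ s in (0 : ℝ)..((i : ℝ) + 1) / n, X s.toNNReal ω) + τ * ε i ω

/-- The squared `L²[0,1]`-distance `‖f - g‖₂²`, with values in `[0, ∞]`. -/
noncomputable def sqL2Dist (f g : ℝ → ℝ) : ℝ≥0∞ :=
  ∫⁻ t in Icc (0 : ℝ) 1, ENNReal.ofReal ((f t - g t) ^ 2)

/-- The minimax risk `inf_{σ̂²} sup_{σ² ∈ V} E (r · ‖σ̂² - σ²‖₂²)` for estimation of the function
`σ²` from `n` observations. The infimum is over all estimators, i.e. all (jointly measurable) maps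
from the observation vector to functions on `[0,1]`. -/
noncomputable def minimaxRiskFun {Ω : Type*} [MeasurableSpace Ω] (P : Measure Ω) (τ : ℝ) (n : ℕ)
    (ε : Fin n → Ω → ℝ) (X : (ℝ → ℝ) → ℝ≥0 → Ω → ℝ) (V : Set (ℝ → ℝ)) (r : ℝ) : ℝ≥0∞ :=
  ⨅ (est : (Fin n → ℝ) → ℝ → ℝ) (_ : Measurable (Function.uncurry est)),
    ⨆ v ∈ V, ∫⁻ ω, ENNReal.ofReal r *
      sqL2Dist (est (integratedObservation τ n (X fun s => √(v s)) ε ω)) v ∂P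

/-- The minimax risk `inf_{σ̂²} sup_{σ² ∈ V} E (r · (σ̂² - σ²)²)` for estimation of the number `σ²`
when the volatility `σ` is constant in time. -/
noncomputable def minimaxRiskConst {Ω : Type*} [MeasurableSpace Ω] (P : Measure Ω) (τ : ℝ) (n : ℕ)
    (ε : Fin n → Ω → ℝ) (X : (ℝ → ℝ) → ℝ≥0 → Ω → ℝ) (V : Set ℝ) (r : ℝ) : ℝ≥0∞ :=
  ⨅ (est : (Fin n → ℝ) → ℝ) (_ : Measurable est),
    ⨆ v ∈ V, ∫⁻ ω, ENNReal.ofReal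
      (r * (est (integratedObservation τ n (X fun _ => √v) ε ω) - v) ^ 2) ∂P

/-!
Under the squared volatility `v` the observation vector is centred Gaussian with covariance
`Σ_v = G_v + τ² I`, where `G_v` is the Gram matrix of the functions `s ↦ (i / n - s)⁺`
in `L²(v ds)`. Adding a small `h ≥ 0` to `v`, with `h ≤ k v`,
keeps the Hellinger affinity of the two laws close to one as long as `k * tr(Σ_v⁻¹ G_h)` is small.

This trace is of order `δ n^{1/4}` when `h ≤ δ`: project the ramps `(x - s)⁺` onto step functions
on `M` cells. The projected part contributes at most `δ M / l`, since `Σ_v` dominates `l` times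
the Gram matrix, and the remainder is of squared norm `O(M⁻³)` for each of the `n` observations;
the noise makes `Σ_v⁻¹ ≤ τ⁻² I`, so `M = n^{1/4}` balances the two. Two constants at distance
`n^{-1/8}` can therefore not be separated, which is part (ii). For part (i) one adds to `l` bumps
of height `a m^{-α}` on an arbitrary subset of `m ≈ n^{1/(8α+4)}` cells; the traces of the single
bumps add up to that of a constant, so Assouad's lemma applies on average over the cells.
-/

section TwoPoint

variable {α : Type*} [MeasurableSpace α] {μ : Measure α}

theorem lintegral_mul_sq_le {f g : α → ℝ≥0∞} (hf : AEMeasurable f μ) (hg : AEMeasurable g μ) :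
    (∫⁻ x, f x * g x ∂μ) ^ 2 ≤ (∫⁻ x, f x ^ 2 ∂μ) * ∫⁻ x, g x ^ 2 ∂μ := by
  have h := ENNReal.lintegral_mul_le_Lp_mul_Lq μ Real.HolderConjugate.two_two hf hg
  simp only [Pi.mul_apply, ENNReal.rpow_two] at h
  calc (∫⁻ x, f x * g x ∂μ) ^ 2
      ≤ ((∫⁻ x, f x ^ 2 ∂μ) ^ (1 / 2 : ℝ) * (∫⁻ x, g x ^ 2 ∂μ) ^ (1 / 2 : ℝ)) ^ 2 := by gcongr
    _ = (∫⁻ x, f x ^ 2 ∂μ) * ∫⁻ x, g x ^ 2 ∂μ := by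
      simp only [mul_pow, ← ENNReal.rpow_two, ← ENNReal.rpow_mul]
      norm_num

/-- Cauchy–Schwarz is applied to `g * r` and to `1 * (h * r)`. -/
theorem sq_mul_affinity_sq_le [IsProbabilityMeasure μ] {r g h : α → ℝ≥0∞} (hr : Measurable r)
    (hg : Measurable g) (hh : Measurable h) (hr1 : ∫⁻ x, r x ^ 2 ∂μ ≤ 1) {c : ℝ≥0∞}
    (hc : ∀ x, c ≤ g x + h x) :
    c ^ 2 * (∫⁻ x, r x ∂μ) ^ 2 ≤
      2 * (∫⁻ x, g x ^ 2 ∂μ + ∫⁻ x, h x ^ 2 ∂(μ.withDensity fun x => r x ^ 2)) := by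
  have first : (∫⁻ x, g x * r x ∂μ) ^ 2 ≤ ∫⁻ x, g x ^ 2 ∂μ :=
    (lintegral_mul_sq_le hg.aemeasurable hr.aemeasurable).trans (mul_le_of_le_one_right' hr1)
  have second : (∫⁻ x, h x * r x ∂μ) ^ 2 ≤ ∫⁻ x, h x ^ 2 ∂(μ.withDensity fun x => r x ^ 2) := by
    have cauchySchwarz := lintegral_mul_sq_le (μ := μ) (f := 1) aemeasurable_const
      (hh.mul hr).aemeasurable
    simp only [Pi.one_apply, one_mul, one_pow, Pi.mul_apply, lintegral_const, measure_univ,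
      mul_pow] at cauchySchwarz
    rw [lintegral_withDensity_eq_lintegral_mul _ (hr.pow_const 2) (hh.pow_const 2)]
    simpa only [Pi.mul_apply, mul_comm] using cauchySchwarz
  calc c ^ 2 * (∫⁻ x, r x ∂μ) ^ 2
      = (∫⁻ x, c * r x ∂μ) ^ 2 := by rw [lintegral_const_mul _ hr, mul_pow]
    _ ≤ (∫⁻ x, g x * r x ∂μ + ∫⁻ x, h x * r x ∂μ) ^ 2 := by
      rw [← lintegral_add_left (f := fun x => g x * r x) (hg.mul hr)]
      gcongr with x
      rw [← add_mul]
      gcongr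
      exact hc x
    _ ≤ 2 * ((∫⁻ x, g x * r x ∂μ) ^ 2 + (∫⁻ x, h x * r x ∂μ) ^ 2) := by
      have h2 := ENNReal.rpow_add_le_mul_rpow_add_rpow (∫⁻ x, g x * r x ∂μ)
        (∫⁻ x, h x * r x ∂μ) one_le_two
      norm_num at h2
      simpa using h2
    _ ≤ _ := by gcongr

end TwoPoint

section Product

variable {ι : Type*} [Fintype ι] {α : ι → Type*} [∀ i, MeasurableSpace (α i)]
  (μ : ∀ i, Measure (α i)) [∀ i, IsProbabilityMeasure (μ i)] {f : ∀ i, α i → ℝ≥0∞}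

theorem lintegral_pi_prod (hf : ∀ i, Measurable (f i)) :
    ∫⁻ x, ∏ i, f i (x i) ∂(Measure.pi μ) = ∏ i, ∫⁻ y, f i y ∂(μ i) := by
  refine (lintegral_prod_eq_prod_lintegral_of_indepFun Finset.univ
    (fun i (x : ∀ i, α i) => f i (x i)) (iIndepFun_pi fun i => (hf i).aemeasurable)
    fun i => (hf i).comp (measurable_pi_apply i)).trans ?_
  exact Finset.prod_congr rfl fun i _ => (measurePreserving_eval μ i).lintegral_comp (hf i)

theorem pi_withDensity (hf : ∀ i, Measurable (f i))
    [∀ i, SigmaFinite ((μ i).withDensity (f i))] :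
    Measure.pi (fun i => (μ i).withDensity (f i)) =
      (Measure.pi μ).withDensity fun x => ∏ i, f i (x i) := by
  refine Measure.pi_eq fun s hs => ?_
  have indicator_prod (x : ∀ i, α i) : (univ.pi s).indicator (fun x => ∏ i, f i (x i)) x =
      ∏ i, (s i).indicator (f i) (x i) := by
    by_cases hx : x ∈ univ.pi s
    · rw [indicator_of_mem hx]
      exact Finset.prod_congr rfl fun i _ => (indicator_of_mem (hx i (mem_univ i)) _).symm
    · obtain ⟨i, hi⟩ : ∃ i, x i ∉ s i := by simpa [mem_univ_pi] using hx
      rw [indicator_of_notMem hx]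
      exact (Finset.prod_eq_zero (Finset.mem_univ i) (indicator_of_notMem hi _)).symm
  rw [withDensity_apply _ (MeasurableSet.univ_pi hs), ← lintegral_indicator
    (MeasurableSet.univ_pi hs), lintegral_congr indicator_prod,
    lintegral_pi_prod _ fun i => (hf i).indicator (hs i)]
  exact Finset.prod_congr rfl fun i _ => by
    rw [lintegral_indicator (hs i), withDensity_apply _ (hs i)]

end Product

/-- The square root of the density of `N(0, d)` with respect to `N(0, 1)`; its integral against
`N(0, 1)` is the Hellinger affinity of the two laws. -/
noncomputable def gaussianSqrtDensity (d x : ℝ) : ℝ :=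
  √(√d)⁻¹ * Real.exp (x ^ 2 / 4 - x ^ 2 / (4 * d))

theorem measurable_gaussianSqrtDensity (d : ℝ) : Measurable (gaussianSqrtDensity d) := by
  unfold gaussianSqrtDensity; fun_prop

theorem gaussianSqrtDensity_nonneg (d x : ℝ) : 0 ≤ gaussianSqrtDensity d x := by
  unfold gaussianSqrtDensity; positivity

theorem gaussianReal_eq_withDensity {d : ℝ≥0} (hd : d ≠ 0) :
    gaussianReal 0 d = (gaussianReal 0 1).withDensity
      fun x => ENNReal.ofReal (gaussianSqrtDensity d x) ^ 2 := by
  rw [gaussianReal_of_var_ne_zero _ hd, gaussianReal_of_var_ne_zero _ one_ne_zero,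
    ← withDensity_mul _ (measurable_gaussianPDF 0 1)
      ((measurable_gaussianSqrtDensity d).ennreal_ofReal.pow_const 2)]
  congr 1
  ext x
  have exp_eq : Real.exp (-(x - 0) ^ 2 / (2 * d)) = Real.exp (-(x - 0) ^ 2 / (2 * 1)) *
      Real.exp ((2 : ℕ) * (x ^ 2 / 4 - x ^ 2 / (4 * d))) := by
    rw [← Real.exp_add]; congr 1; push_cast; field_simp; ring
  have sqrt_eq : √(2 * Real.pi * d) = √(2 * Real.pi * 1) * √d := by
    rw [mul_one, Real.sqrt_mul (by positivity)]
  rw [Pi.mul_apply, gaussianPDF, gaussianPDF, ← ENNReal.ofReal_pow (gaussianSqrtDensity_nonneg _ _),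
    ← ENNReal.ofReal_mul (gaussianPDFReal_nonneg _ _ _)]
  congr 1
  rw [gaussianPDFReal, gaussianPDFReal, gaussianSqrtDensity, mul_pow, Real.sq_sqrt (by positivity),
    ← Real.exp_nat_mul, NNReal.coe_one, exp_eq, sqrt_eq, mul_inv]
  ring

theorem lintegral_gaussianSqrtDensity {d : ℝ} (hd : 0 < d) :
    ∫⁻ x, ENNReal.ofReal (gaussianSqrtDensity d x) ∂(gaussianReal 0 1) =
      ENNReal.ofReal √(2 * √d / (1 + d)) := by
  have hb : 0 < (1 + d) / (4 * d) := by positivity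
  have product (x : ℝ) :
      (gaussianPDF 0 1 * fun x => ENNReal.ofReal (gaussianSqrtDensity d x)) x =
      ENNReal.ofReal ((√(2 * Real.pi))⁻¹ * √(√d)⁻¹ *
        Real.exp (-((1 + d) / (4 * d)) * x ^ 2)) := by
    have exp_eq : Real.exp (-((1 + d) / (4 * d)) * x ^ 2) =
        Real.exp (-(x - 0) ^ 2 / (2 * (1 : ℝ≥0))) *
          Real.exp (x ^ 2 / 4 - x ^ 2 / (4 * d)) := by
      rw [← Real.exp_add]; congr 1; push_cast; field_simp; ring
    rw [Pi.mul_apply, gaussianPDF, ← ENNReal.ofReal_mul (gaussianPDFReal_nonneg _ _ _),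
      gaussianPDFReal, gaussianSqrtDensity, exp_eq, NNReal.coe_one, mul_one]
    congr 1
    ring
  rw [gaussianReal_of_var_ne_zero _ one_ne_zero,
    lintegral_withDensity_eq_lintegral_mul _ (measurable_gaussianPDF 0 1)
      (measurable_gaussianSqrtDensity d).ennreal_ofReal, lintegral_congr product,
    ← ofReal_integral_eq_lintegral_ofReal ((integrable_exp_neg_mul_sq hb).const_mul _)
      (ae_of_all _ fun x => by positivity), integral_const_mul, integral_gaussian]
  rw [← Real.sqrt_inv, ← Real.sqrt_mul (by positivity), ← Real.sqrt_mul (by positivity)]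
  congr 2
  field_simp
  rw [Real.sq_sqrt hd.le]
  ring

theorem exp_le_sqrt_two_mul_sqrt_div {t : ℝ} (ht : 0 ≤ t) :
    Real.exp (-t ^ 2 / 16) ≤ √(2 * √(1 + t) / (1 + (1 + t))) := by
  have key : Real.exp (-t ^ 2 / 4) ≤ (1 + t) / (1 + t / 2) ^ 2 := by
    rw [neg_div, Real.exp_neg, ← inv_div ((1 + t / 2) ^ 2)]
    refine inv_anti₀ (by positivity) (le_trans ?_ (Real.add_one_le_exp _))
    rw [div_le_iff₀ (by positivity)]
    nlinarith [pow_nonneg ht 3]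
  have sqrt_eq : 2 * √(1 + t) / (1 + (1 + t)) = √((1 + t) / (1 + t / 2) ^ 2) := by
    rw [Real.sqrt_div' _ (by positivity), Real.sqrt_sq (by positivity)]
    field_simp
    ring
  rw [sqrt_eq]
  refine Real.le_sqrt_of_sq_le (Real.le_sqrt_of_sq_le ?_)
  rw [← pow_mul, ← Real.exp_nat_mul]
  convert key using 2
  push_cast
  ring

section PiGaussian

variable {ι : Type*} [Fintype ι] (t : ι → ℝ≥0)

theorem measurable_ofReal_gaussianSqrtDensity (d : ℝ) :
    Measurable fun x => ENNReal.ofReal (gaussianSqrtDensity d x) :=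
  (measurable_gaussianSqrtDensity d).ennreal_ofReal

theorem pi_gaussianReal_eq_withDensity :
    Measure.pi (fun i => gaussianReal 0 (1 + t i)) =
      (Measure.pi fun _ => gaussianReal 0 1).withDensity fun x =>
        (∏ i, ENNReal.ofReal (gaussianSqrtDensity (1 + t i) (x i))) ^ 2 := by
  have e (i : ι) : gaussianReal 0 (1 + t i) = (gaussianReal 0 1).withDensity
      fun x => ENNReal.ofReal (gaussianSqrtDensity (1 + t i) x) ^ 2 := by
    simpa using gaussianReal_eq_withDensity (d := 1 + t i) (by positivity)
  have (i : ι) : SigmaFinite ((gaussianReal 0 1).withDensity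
      fun x => ENNReal.ofReal (gaussianSqrtDensity (1 + t i) x) ^ 2) := by
    rw [← e]; infer_instance
  simp_rw [e, ← Finset.prod_pow]
  exact pi_withDensity _ fun i => (measurable_ofReal_gaussianSqrtDensity _).pow_const 2

theorem exp_le_lintegral_prod_gaussianSqrtDensity :
    ENNReal.ofReal (Real.exp (-(∑ i, (t i : ℝ) ^ 2) / 16)) ≤
      ∫⁻ x, ∏ i, ENNReal.ofReal (gaussianSqrtDensity (1 + t i) (x i))
        ∂(Measure.pi fun _ => gaussianReal 0 1) := by
  rw [lintegral_pi_prod _ fun i => measurable_ofReal_gaussianSqrtDensity (1 + t i), neg_div,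
    Finset.sum_div, ← Finset.sum_neg_distrib, Real.exp_sum,
    ENNReal.ofReal_prod_of_nonneg fun i _ => Real.exp_nonneg _]
  refine Finset.prod_le_prod' fun i _ => ?_
  rw [lintegral_gaussianSqrtDensity (by positivity), ← neg_div]
  exact ENNReal.ofReal_le_ofReal (exp_le_sqrt_two_mul_sqrt_div (t i).2)

theorem two_point_pi_gaussianReal {f : (ι → ℝ) → ℝ} (hf : Measurable f) (a b : ℝ) :
    ENNReal.ofReal ((a - b) ^ 2 / 2 * Real.exp (-(∑ i, (t i : ℝ) ^ 2) / 8)) ≤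
      ∫⁻ x, ENNReal.ofReal ((f x - a) ^ 2) ∂(Measure.pi fun _ => gaussianReal 0 1) +
      ∫⁻ x, ENNReal.ofReal ((f x - b) ^ 2) ∂(Measure.pi fun i => gaussianReal 0 (1 + t i)) := by
  have mass := prob_le_one (μ := Measure.pi fun i => gaussianReal 0 (1 + t i)) (s := univ)
  rw [pi_gaussianReal_eq_withDensity, withDensity_apply _ MeasurableSet.univ,
    setLIntegral_univ] at mass
  have affinity := sq_mul_affinity_sq_le (Finset.measurable_prod _ fun i _ =>
      (measurable_ofReal_gaussianSqrtDensity (1 + t i)).comp (measurable_pi_apply i))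
    (hf.sub_const a).abs.ennreal_ofReal (hf.sub_const b).abs.ennreal_ofReal mass
    (c := ENNReal.ofReal |a - b|) fun x => by
      rw [← ENNReal.ofReal_add (abs_nonneg _) (abs_nonneg _), abs_sub_comm (f x) a]
      exact ENNReal.ofReal_le_ofReal (abs_sub_le a (f x) b)
  simp only [Function.comp_apply, ← pi_gaussianReal_eq_withDensity,
    ← ENNReal.ofReal_pow (abs_nonneg _), sq_abs] at affinity
  rw [← ENNReal.mul_le_mul_iff_right two_ne_zero ENNReal.ofNat_ne_top]
  refine le_trans ?_ affinity
  calc 2 * ENNReal.ofReal ((a - b) ^ 2 / 2 * Real.exp (-(∑ i, (t i : ℝ) ^ 2) / 8))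
      = ENNReal.ofReal ((a - b) ^ 2) *
          ENNReal.ofReal (Real.exp (-(∑ i, (t i : ℝ) ^ 2) / 16)) ^ 2 := by
        rw [← ENNReal.ofReal_pow (Real.exp_nonneg _), ← Real.exp_nat_mul,
          ← ENNReal.ofReal_mul (sq_nonneg _), ← ENNReal.ofReal_ofNat 2,
          ← ENNReal.ofReal_mul zero_le_two]
        congr 1
        push_cast
        ring_nf
    _ ≤ _ := by gcongr; exact exp_le_lintegral_prod_gaussianSqrtDensity t

end PiGaussian

section MultivariateGaussian

open Matrix WithLp
open scoped MatrixOrder RealInnerProductSpace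

variable {ι κ : Type*} [Fintype ι] [DecidableEq ι] [Fintype κ] [DecidableEq κ]

theorem map_mulVec_pi_gaussianReal (B : Matrix κ ι ℝ) (d : ι → ℝ≥0) :
    (Measure.pi fun i => gaussianReal 0 (d i)).map (fun x => toLp 2 (B *ᵥ x)) =
      multivariateGaussian 0 (B * diagonal (fun i => (d i : ℝ)) * Bᵀ) := by
  have hdiag : (diagonal fun i => (d i : ℝ)).PosSemidef := .diagonal fun i => (d i).2
  have hcov : (B * diagonal (fun i => (d i : ℝ)) * Bᵀ).PosSemidef := by
    simpa only [conjTranspose_eq_transpose_of_trivial] using hdiag.mul_mul_conjTranspose_same B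
  have hB : Measurable fun x : ι → ℝ => toLp 2 (B *ᵥ x) :=
    (PiLp.continuous_toLp 2 _ |>.comp (continuous_const.matrix_mulVec continuous_id)).measurable
  refine Measure.ext_of_charFun (funext fun u => ?_)
  have adjoint (x : ι → ℝ) : ⟪toLp 2 (B *ᵥ x), u⟫ = ⟪toLp 2 x, toLp 2 (Bᵀ *ᵥ u.ofLp)⟫ := by
    simp only [EuclideanSpace.inner_eq_star_dotProduct, star_trivial, mulVec_transpose,
      dotProduct_mulVec]
  have variance : u.ofLp ⬝ᵥ (B * diagonal (fun i => (d i : ℝ)) * Bᵀ) *ᵥ u.ofLp =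
      ∑ i, d i * (Bᵀ *ᵥ u.ofLp) i ^ 2 := by
    rw [← mulVec_mulVec, ← mulVec_mulVec, dotProduct_mulVec, ← mulVec_transpose, dotProduct]
    exact Finset.sum_congr rfl fun i _ => by rw [mulVec_diagonal]; ring
  rw [charFun_multivariateGaussian hcov, inner_zero_right, variance, charFun_apply,
    integral_map hB.aemeasurable (by fun_prop)]
  simp_rw [adjoint]
  rw [← integral_map (φ := toLp 2) (f := fun x => Complex.exp
    (⟪x, toLp 2 (Bᵀ *ᵥ u.ofLp)⟫ * Complex.I)) (by fun_prop) (by fun_prop), ← charFun_apply,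
    charFun_pi]
  simp only [charFun_gaussianReal, ← Complex.exp_sum]
  congr 1
  push_cast
  simp [Finset.sum_neg_distrib, Finset.sum_div]

theorem exists_simultaneous_diagonalization {A K : Matrix ι ι ℝ} (hA : A.PosDef)
    (hK : K.PosSemidef) :
    ∃ (B : Matrix ι ι ℝ) (d : ι → ℝ≥0), IsUnit B ∧ B * Bᵀ = A ∧
      B * diagonal (fun i => (d i : ℝ)) * Bᵀ = K := by
  set R := CFC.sqrt A
  have hR : Rᵀ = R := (CFC.sqrt_nonneg A).posSemidef.isHermitian
  have hRR : R * R = A := CFC.sqrt_mul_sqrt_self A hA.posSemidef.nonneg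
  have hRunit : IsUnit R := isUnit_of_mul_isUnit_left (hRR ▸ hA.isUnit)
  have hRdet := (isUnit_iff_isUnit_det R).1 hRunit
  have hM : (R⁻¹ * K * R⁻¹).PosSemidef := by
    simpa only [conjTranspose_eq_transpose_of_trivial, transpose_nonsing_inv, hR]
      using hK.mul_mul_conjTranspose_same R⁻¹
  set U : Matrix ι ι ℝ := (hM.1.eigenvectorUnitary : Matrix ι ι ℝ)
  have hUt : Uᵀ = star U := by
    rw [star_eq_conjTranspose, conjTranspose_eq_transpose_of_trivial]
  have hU : U * star U = 1 := Unitary.coe_mul_star_self _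
  have hspec : R⁻¹ * K * R⁻¹ = U * diagonal hM.1.eigenvalues * star U := hM.1.spectral_theorem
  refine ⟨R * U, fun i => ⟨hM.1.eigenvalues i, hM.eigenvalues_nonneg i⟩,
    hRunit.mul (IsUnit.of_mul_eq_one _ hU), ?_, ?_⟩
  · rw [transpose_mul, hUt, hR, Matrix.mul_assoc, ← Matrix.mul_assoc U, hU, Matrix.one_mul, hRR]
  · calc R * U * diagonal hM.1.eigenvalues * (R * U)ᵀ
        = R * (U * diagonal hM.1.eigenvalues * star U) * R := by
          rw [transpose_mul, hUt, hR]; simp only [Matrix.mul_assoc]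
      _ = K := by
          rw [← hspec, ← Matrix.mul_assoc, ← Matrix.mul_assoc, mul_nonsing_inv _ hRdet,
            Matrix.one_mul, Matrix.mul_assoc, nonsing_inv_mul _ hRdet, Matrix.mul_one]

theorem trace_inv_mul_congruence {B D : Matrix ι ι ℝ} (hB : IsUnit B) :
    ((B * Bᵀ)⁻¹ * (B * D * Bᵀ)).trace = D.trace := by
  have hdet := (isUnit_iff_isUnit_det B).1 hB
  rw [Matrix.mul_inv_rev, Matrix.mul_assoc, ← Matrix.mul_assoc B⁻¹, ← Matrix.mul_assoc B⁻¹,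
    nonsing_inv_mul _ hdet, Matrix.one_mul, trace_mul_comm, Matrix.mul_assoc,
    mul_nonsing_inv _ (by rwa [det_transpose]), Matrix.mul_one]

theorem le_of_posSemidef_smul_sub_congruence {B : Matrix ι ι ℝ} (hB : IsUnit B) {d : ι → ℝ} {k : ℝ}
    (h : (k • (B * Bᵀ) - B * diagonal d * Bᵀ).PosSemidef) (i : ι) : d i ≤ k := by
  have conj : k • (B * Bᵀ) - B * diagonal d * Bᵀ = B * diagonal (fun i => k - d i) * star B := by
    rw [← diagonal_sub, Matrix.mul_sub, Matrix.sub_mul, ← smul_one_eq_diagonal, Matrix.mul_smul,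
      Matrix.smul_mul, Matrix.mul_one, star_eq_conjTranspose, conjTranspose_eq_transpose_of_trivial]
  rw [conj, hB.posSemidef_star_right_conjugate_iff, posSemidef_diagonal_iff] at h
  exact sub_nonneg.1 (h i)

theorem two_point_multivariateGaussian {A K : Matrix ι ι ℝ} (hA : A.PosDef) (hK : K.PosSemidef)
    {k : ℝ} (hk : (k • A - K).PosSemidef) {f : EuclideanSpace ℝ ι → ℝ} (hf : Measurable f)
    (a b : ℝ) :
    ENNReal.ofReal ((a - b) ^ 2 / 2 * (1 - k / 8 * (A⁻¹ * K).trace)) ≤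
      ∫⁻ x, ENNReal.ofReal ((f x - a) ^ 2) ∂(multivariateGaussian 0 A) +
      ∫⁻ x, ENNReal.ofReal ((f x - b) ^ 2) ∂(multivariateGaussian 0 (A + K)) := by
  obtain ⟨B, d, hB, rfl, rfl⟩ := exists_simultaneous_diagonalization hA hK
  have hBmeas : Measurable fun x : ι → ℝ => toLp 2 (B *ᵥ x) :=
    (PiLp.continuous_toLp 2 _ |>.comp (continuous_const.matrix_mulVec continuous_id)).measurable
  have hlaw : multivariateGaussian 0 (B * Bᵀ) =
      (Measure.pi fun _ => gaussianReal 0 1).map (fun x => toLp 2 (B *ᵥ x)) := by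
    simp [map_mulVec_pi_gaussianReal]
  have hlaw' : multivariateGaussian 0 (B * Bᵀ + B * diagonal (fun i => (d i : ℝ)) * Bᵀ) =
      (Measure.pi fun i => gaussianReal 0 (1 + d i)).map (fun x => toLp 2 (B *ᵥ x)) := by
    rw [map_mulVec_pi_gaussianReal]
    congr 1
    simp only [NNReal.coe_add, NNReal.coe_one, ← diagonal_add, diagonal_one, Matrix.mul_add,
      Matrix.mul_one, Matrix.add_mul]
  rw [hlaw, hlaw', lintegral_map (by fun_prop) hBmeas, lintegral_map (by fun_prop) hBmeas]
  refine le_trans (ENNReal.ofReal_le_ofReal ?_)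
    (two_point_pi_gaussianReal d (hf.comp hBmeas) a b)
  rw [trace_inv_mul_congruence hB, trace_diagonal]
  have hsq : ∑ i, (d i : ℝ) ^ 2 ≤ k * ∑ i, (d i : ℝ) := by
    rw [Finset.mul_sum]
    refine Finset.sum_le_sum fun i _ => ?_
    rw [sq]
    exact mul_le_mul_of_nonneg_right (le_of_posSemidef_smul_sub_congruence hB hk i) (d i).2
  gcongr
  linarith [Real.add_one_le_exp (-(∑ i, (d i : ℝ) ^ 2) / 8)]

end MultivariateGaussian

section TraceBound

open Matrix
open scoped RealInnerProductSpace

variable {H : Type*} [NormedAddCommGroup H] [InnerProductSpace ℝ H]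

theorem gram_eq_gram_starProjection_add (S : Submodule ℝ H) [S.HasOrthogonalProjection]
    {ι : Type*} (g : ι → H) : gram ℝ g = gram ℝ (fun i => S.starProjection (g i)) +
      gram ℝ fun i => g i - S.starProjection (g i) := by
  ext i j
  have h1 := S.starProjection_inner_eq_zero (g i) _ (S.starProjection_apply_mem (g j))
  have h2 := S.starProjection_inner_eq_zero (g j) _ (S.starProjection_apply_mem (g i))
  rw [real_inner_comm] at h2
  simp only [inner_sub_left, inner_sub_right, Matrix.add_apply, gram_apply] at *
  linarith

variable {ι : Type*} [Fintype ι]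

theorem trace_mul_nonneg_of_posSemidef {A B : Matrix ι ι ℝ} (hA : A.PosSemidef)
    (hB : B.PosSemidef) : 0 ≤ (A * B).trace := by
  classical
  open scoped MatrixOrder in
  obtain ⟨C, rfl⟩ := CStarAlgebra.nonneg_iff_eq_star_mul_self.mp hB.nonneg
  rw [← Matrix.mul_assoc, trace_mul_comm, ← Matrix.mul_assoc]
  exact (hA.mul_mul_conjTranspose_same C).trace_nonneg

theorem dotProduct_mulVec_le_of_posSemidef_sub {A B : Matrix ι ι ℝ} (h : (A - B).PosSemidef)
    (y : ι → ℝ) : y ⬝ᵥ B *ᵥ y ≤ y ⬝ᵥ A *ᵥ y := by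
  simpa [sub_mulVec, dotProduct_sub] using h.dotProduct_mulVec_nonneg y

theorem trace_mul_gram_eq_sum (A : Matrix ι ι ℝ) {κ : Type*} [Fintype κ] {S : Submodule ℝ H}
    (e : OrthonormalBasis κ ℝ S) {p : ι → H} (hp : ∀ i, p i ∈ S) :
    (A * gram ℝ p).trace =
      ∑ k, (fun i => ⟪(e k : H), p i⟫) ⬝ᵥ A *ᵥ fun i => ⟪(e k : H), p i⟫ := by
  have parseval (i j : ι) : ⟪p j, p i⟫ = ∑ k, ⟪p j, (e k : H)⟫ * ⟪(e k : H), p i⟫ :=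
    (e.sum_inner_mul_inner ⟨p j, hp j⟩ ⟨p i, hp i⟩).symm
  simp only [trace, diag_apply, Matrix.mul_apply, gram_apply, parseval, dotProduct, mulVec,
    Finset.mul_sum]
  rw [Finset.sum_congr rfl fun i _ => Finset.sum_comm, Finset.sum_comm]
  refine Finset.sum_congr rfl fun k _ => Finset.sum_congr rfl fun i _ =>
    Finset.sum_congr rfl fun j _ => ?_
  rw [real_inner_comm (p j)]
  ring

variable [DecidableEq ι]

/-- The optimal constant is attained at `y = A⁻¹ x`. -/
theorem dotProduct_inv_mulVec_le {A : Matrix ι ι ℝ} (hA : A.PosDef) {x : ι → ℝ} {c : ℝ}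
    (hc : 0 ≤ c) (h : ∀ y, (x ⬝ᵥ y) ^ 2 ≤ c * (y ⬝ᵥ A *ᵥ y)) : x ⬝ᵥ A⁻¹ *ᵥ x ≤ c := by
  have hx := h (A⁻¹ *ᵥ x)
  rw [mulVec_mulVec, mul_nonsing_inv _ ((isUnit_iff_isUnit_det A).1 hA.isUnit), one_mulVec,
    dotProduct_comm (A⁻¹ *ᵥ x), sq] at hx
  by_contra! hlt
  nlinarith

theorem inv_posSemidef_sub {A : Matrix ι ι ℝ} (hA : A.PosDef) {t : ℝ} (ht : 0 < t)
    (h : (A - t • (1 : Matrix ι ι ℝ)).PosSemidef) :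
    (t⁻¹ • (1 : Matrix ι ι ℝ) - A⁻¹).PosSemidef := by
  refine .of_dotProduct_mulVec_nonneg
    ((isHermitian_one.smul (IsSelfAdjoint.all _)).sub hA.isHermitian.inv) fun x => ?_
  rw [star_trivial, sub_mulVec, smul_mulVec, one_mulVec, dotProduct_sub, dotProduct_smul,
    smul_eq_mul, sub_nonneg]
  have hxx : 0 ≤ x ⬝ᵥ x := dotProduct_self_star_nonneg x
  refine dotProduct_inv_mulVec_le hA (by positivity) fun y => ?_
  have cauchySchwarz : (x ⬝ᵥ y) ^ 2 ≤ (x ⬝ᵥ x) * (y ⬝ᵥ y) := by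
    simpa only [dotProduct, sq] using Finset.sum_mul_sq_le_sq_mul_sq Finset.univ x y
  have hy := dotProduct_mulVec_le_of_posSemidef_sub h y
  rw [smul_mulVec, one_mulVec, dotProduct_smul, smul_eq_mul] at hy
  calc (x ⬝ᵥ y) ^ 2 ≤ (x ⬝ᵥ x) * (y ⬝ᵥ y) := cauchySchwarz
    _ = t⁻¹ * (x ⬝ᵥ x) * (t * (y ⬝ᵥ y)) := by field_simp
    _ ≤ t⁻¹ * (x ⬝ᵥ x) * (y ⬝ᵥ A *ᵥ y) := by gcongr

theorem trace_inv_mul_gram_starProjection_le {A : Matrix ι ι ℝ} (hA : A.PosDef) {g : ι → H}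
    {l : ℝ} (hl : 0 < l) (hg : (A - l • gram ℝ g).PosSemidef) (S : Submodule ℝ H)
    [FiniteDimensional ℝ S] :
    (A⁻¹ * gram ℝ fun i => S.starProjection (g i)).trace ≤ Module.finrank ℝ S / l := by
  rw [trace_mul_gram_eq_sum _ (stdOrthonormalBasis ℝ S) fun i => S.starProjection_apply_mem _]
  set e := stdOrthonormalBasis ℝ S
  have each (k) : (fun i => ⟪(e k : H), S.starProjection (g i)⟫) ⬝ᵥ
      A⁻¹ *ᵥ (fun i => ⟪(e k : H), S.starProjection (g i)⟫) ≤ l⁻¹ := by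
    refine dotProduct_inv_mulVec_le hA (inv_nonneg.2 hl.le) fun y => ?_
    have linear : (fun i => ⟪(e k : H), S.starProjection (g i)⟫) ⬝ᵥ y =
        ⟪(e k : H), ∑ i, y i • g i⟫ := by
      simp only [← S.inner_starProjection_left_eq_right,
        S.starProjection_eq_self_iff.2 (e k).2, dotProduct, inner_sum, inner_smul_right, mul_comm]
    have norm_sq : y ⬝ᵥ gram ℝ g *ᵥ y = ‖∑ i, y i • g i‖ ^ 2 := by
      simpa using star_dotProduct_gram_mulVec (𝕜 := ℝ) g y y
    have hy := dotProduct_mulVec_le_of_posSemidef_sub hg y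
    rw [smul_mulVec, dotProduct_smul, smul_eq_mul, norm_sq] at hy
    have cauchySchwarz := abs_real_inner_le_norm (e k : H) (∑ i, y i • g i)
    have unit : ‖(e k : H)‖ = 1 := e.orthonormal.1 k
    rw [unit, one_mul] at cauchySchwarz
    rw [linear, ← sq_abs, le_inv_mul_iff₀ hl]
    exact le_trans (by gcongr) hy
  calc _ ≤ ∑ _k : Fin (Module.finrank ℝ S), l⁻¹ := Finset.sum_le_sum fun k _ => each k
    _ = Module.finrank ℝ S / l := by simp [div_eq_mul_inv]

theorem trace_inv_mul_gram_le {A : Matrix ι ι ℝ} (hA : A.PosDef) {g : ι → H} {l t η : ℝ}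
    (hl : 0 < l) (ht : 0 < t) (hg : (A - l • gram ℝ g).PosSemidef)
    (hone : (A - t • (1 : Matrix ι ι ℝ)).PosSemidef) (S : Submodule ℝ H) [FiniteDimensional ℝ S]
    (hS : ∀ i, ∃ p ∈ S, ‖g i - p‖ ^ 2 ≤ η) :
    (A⁻¹ * gram ℝ g).trace ≤ Module.finrank ℝ S / l + Fintype.card ι * η / t := by
  have residual_le (i : ι) : ‖g i - S.starProjection (g i)‖ ^ 2 ≤ η := by
    obtain ⟨p, hp, hpη⟩ := hS i
    refine le_trans ?_ hpη
    gcongr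
    rw [S.starProjection_minimal]
    exact ciInf_le ⟨0, by rintro _ ⟨x, rfl⟩; positivity⟩ (⟨p, hp⟩ : S)
  have residual_trace : (A⁻¹ * gram ℝ fun i => g i - S.starProjection (g i)).trace ≤
      Fintype.card ι * η / t := by
    have h := trace_mul_nonneg_of_posSemidef (inv_posSemidef_sub hA ht hone)
      (posSemidef_gram ℝ fun i => g i - S.starProjection (g i))
    rw [Matrix.sub_mul, Matrix.smul_mul, Matrix.one_mul, trace_sub, trace_smul, sub_nonneg] at h
    refine h.trans ?_
    rw [smul_eq_mul, div_eq_inv_mul]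
    gcongr
    simp only [trace, diag_apply, gram_apply, real_inner_self_eq_norm_sq]
    simpa using Finset.sum_le_sum fun i (_ : i ∈ Finset.univ) => residual_le i
  rw [gram_eq_gram_starProjection_add S g, Matrix.mul_add, trace_add]
  exact add_le_add (trace_inv_mul_gram_starProjection_le hA hl hg S) residual_trace

end TraceBound

/-- The weighted Gram matrix `(∫_0^1 v φ_i φ_j)_{i,j}` of the functions `φ_i`, the covariance matrix
of the Wiener integrals of the `φ_i √v`. -/
noncomputable def weightedGram {ι : Type*} (φ : ι → ℝ → ℝ) (v : ℝ → ℝ) : Matrix ι ι ℝ :=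
  Matrix.of fun i j => ∫ s in (0 : ℝ)..1, v s * (φ i s * φ j s)

section WeightedGram

open Matrix
open scoped RealInnerProductSpace

variable {ι κ : Type*} {φ : ι → ℝ → ℝ} {v w : ℝ → ℝ}

theorem intervalIntegrable_of_continuousOn_Icc {f : ℝ → ℝ} (hf : ContinuousOn f (Icc 0 1)) :
    IntervalIntegrable f volume 0 1 :=
  ContinuousOn.intervalIntegrable (by rwa [uIcc_of_le zero_le_one])

theorem intervalIntegrable_weightedGram (hφ : ∀ i, Continuous (φ i)) (hv : ContinuousOn v (Icc 0 1))
    (i j : ι) : IntervalIntegrable (fun s => v s * (φ i s * φ j s)) volume 0 1 :=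
  intervalIntegrable_of_continuousOn_Icc (hv.mul ((hφ i).mul (hφ j)).continuousOn)

theorem weightedGram_add (hφ : ∀ i, Continuous (φ i)) (hv : ContinuousOn v (Icc 0 1))
    (hw : ContinuousOn w (Icc 0 1)) :
    weightedGram φ (fun s => v s + w s) = weightedGram φ v + weightedGram φ w := by
  ext i j
  simp only [weightedGram, of_apply, Matrix.add_apply, add_mul]
  exact intervalIntegral.integral_add (intervalIntegrable_weightedGram hφ hv i j)
    (intervalIntegrable_weightedGram hφ hw i j)

theorem weightedGram_const_mul (c : ℝ) :
    weightedGram φ (fun s => c * v s) = c • weightedGram φ v := by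
  ext i j
  simp only [weightedGram, of_apply, Matrix.smul_apply, mul_assoc, smul_eq_mul,
    intervalIntegral.integral_const_mul]

theorem weightedGram_sum (hφ : ∀ i, Continuous (φ i)) (t : Finset κ) {f : κ → ℝ → ℝ}
    (hf : ∀ k ∈ t, ContinuousOn (f k) (Icc 0 1)) :
    weightedGram φ (fun s => ∑ k ∈ t, f k s) = ∑ k ∈ t, weightedGram φ (f k) := by
  ext i j
  simp only [weightedGram, of_apply, Matrix.sum_apply, Finset.sum_mul]
  exact intervalIntegral.integral_finsetSum fun k hk =>
    intervalIntegrable_weightedGram hφ (hf k hk) i j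

theorem memLp_Ioc_of_continuous {f : ℝ → ℝ} (hf : Continuous f) :
    MemLp f 2 (volume.restrict (Ioc (0 : ℝ) 1)) := by
  obtain ⟨B, hB⟩ := (isCompact_Icc (a := (0 : ℝ)) (b := 1)).exists_bound_of_continuousOn
    hf.continuousOn
  exact MemLp.of_bound hf.aestronglyMeasurable B
    ((ae_restrict_iff' measurableSet_Ioc).2 (ae_of_all _ fun s hs => hB s ⟨hs.1.le, hs.2⟩))

theorem gram_toLp_eq_weightedGram (hφ : ∀ i, Continuous (φ i)) :
    gram ℝ (fun i => (memLp_Ioc_of_continuous (hφ i)).toLp) = weightedGram φ fun _ => 1 := by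
  ext i j
  rw [gram_apply, L2.inner_def, weightedGram, of_apply,
    intervalIntegral.integral_of_le zero_le_one]
  refine integral_congr_ae ?_
  filter_upwards [(memLp_Ioc_of_continuous (hφ i)).coeFn_toLp,
    (memLp_Ioc_of_continuous (hφ j)).coeFn_toLp] with s hi hj
  rw [hi, hj, one_mul, real_inner_comm]
  rfl

theorem dotProduct_weightedGram_mulVec [Fintype ι] (hφ : ∀ i, Continuous (φ i))
    (hv : ContinuousOn v (Icc 0 1)) (u : ι → ℝ) :
    u ⬝ᵥ weightedGram φ v *ᵥ u = ∫ s in (0 : ℝ)..1, v s * (∑ i, u i * φ i s) ^ 2 := by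
  have expand (s : ℝ) : v s * (∑ i, u i * φ i s) ^ 2 =
      ∑ i, ∑ j, (u i * u j) * (v s * (φ i s * φ j s)) := by
    rw [sq, Finset.sum_mul_sum, Finset.mul_sum]
    refine Finset.sum_congr rfl fun i _ => ?_
    rw [Finset.mul_sum]
    exact Finset.sum_congr rfl fun j _ => by ring
  simp_rw [expand]
  rw [intervalIntegral.integral_finsetSum fun i _ =>
    intervalIntegrable_of_continuousOn_Icc (by fun_prop)]
  simp only [dotProduct, mulVec, weightedGram, of_apply]
  refine Finset.sum_congr rfl fun i _ => ?_
  rw [intervalIntegral.integral_finsetSum fun j _ =>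
    (intervalIntegrable_weightedGram hφ hv i j).const_mul _, Finset.mul_sum]
  refine Finset.sum_congr rfl fun j _ => ?_
  rw [intervalIntegral.integral_const_mul]
  ring

section Finite

variable [Finite ι]

theorem posSemidef_weightedGram (hφ : ∀ i, Continuous (φ i)) (hv : ContinuousOn v (Icc 0 1))
    (hv0 : ∀ s ∈ Icc (0 : ℝ) 1, 0 ≤ v s) : (weightedGram φ v).PosSemidef := by
  have := Fintype.ofFinite ι
  refine .of_dotProduct_mulVec_nonneg ?_ fun u => ?_
  · ext i j
    simp only [weightedGram, conjTranspose_apply, of_apply, star_trivial, mul_comm (φ j _)]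
  · rw [star_trivial, dotProduct_weightedGram_mulVec hφ hv]
    exact intervalIntegral.integral_nonneg zero_le_one fun s hs =>
      mul_nonneg (hv0 s hs) (sq_nonneg _)

theorem posSemidef_smul_weightedGram_sub (hφ : ∀ i, Continuous (φ i))
    (hv : ContinuousOn v (Icc 0 1)) (hw : ContinuousOn w (Icc 0 1)) {c : ℝ}
    (hvw : ∀ s ∈ Icc (0 : ℝ) 1, w s ≤ c * v s) :
    (c • weightedGram φ v - weightedGram φ w).PosSemidef := by
  have split : c • weightedGram φ v = weightedGram φ (fun s => c * v s - w s) +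
      weightedGram φ w := by
    rw [← weightedGram_const_mul,
      ← weightedGram_add (v := fun s => c * v s - w s) hφ ((continuousOn_const.mul hv).sub hw) hw]
    simp only [sub_add_cancel]
  rw [split, add_sub_cancel_right]
  exact posSemidef_weightedGram hφ ((continuousOn_const.mul hv).sub hw)
    fun s hs => sub_nonneg.2 (hvw s hs)

theorem posDef_weightedGram_add_smul_one [DecidableEq ι] (hφ : ∀ i, Continuous (φ i))
    (hv : ContinuousOn v (Icc 0 1)) (hv0 : ∀ s ∈ Icc (0 : ℝ) 1, 0 ≤ v s) {t : ℝ} (ht : 0 < t) :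
    (weightedGram φ v + t • (1 : Matrix ι ι ℝ)).PosDef :=
  PosDef.posSemidef_add (posSemidef_weightedGram hφ hv hv0) (PosDef.one.smul ht)

end Finite

theorem trace_inv_mul_weightedGram_le [Fintype ι] [DecidableEq ι]
    (hφ : ∀ i, Continuous (φ i)) (hv : ContinuousOn v (Icc 0 1)) {l δ t η : ℝ} (hl : 0 < l)
    (hvl : ∀ s ∈ Icc (0 : ℝ) 1, l ≤ v s) (hw : ContinuousOn w (Icc 0 1)) (hδ : 0 ≤ δ)
    (hwδ : ∀ s ∈ Icc (0 : ℝ) 1, w s ≤ δ) (ht : 0 < t)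
    (S : Submodule ℝ (Lp ℝ 2 (volume.restrict (Ioc (0 : ℝ) 1)))) [FiniteDimensional ℝ S]
    (hS : ∀ i, ∃ p ∈ S, ‖(memLp_Ioc_of_continuous (hφ i)).toLp - p‖ ^ 2 ≤ η) :
    ((weightedGram φ v + t • (1 : Matrix ι ι ℝ))⁻¹ * weightedGram φ w).trace ≤
      δ * (Module.finrank ℝ S / l + Fintype.card ι * η / t) := by
  have hv0 (s) (hs : s ∈ Icc (0 : ℝ) 1) : 0 ≤ v s := hl.le.trans (hvl s hs)
  have hA := posDef_weightedGram_add_smul_one hφ hv hv0 ht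
  have dominate : (weightedGram φ v + t • (1 : Matrix ι ι ℝ) -
      l • gram ℝ fun i => (memLp_Ioc_of_continuous (hφ i)).toLp).PosSemidef := by
    have h := posSemidef_smul_weightedGram_sub (c := 1) hφ hv
      (continuousOn_const (c := l * 1)) fun s hs => by simpa using hvl s hs
    rw [one_smul] at h
    rw [gram_toLp_eq_weightedGram hφ, ← weightedGram_const_mul, add_sub_right_comm]
    exact h.add (PosSemidef.one.smul ht.le)
  have bound := trace_inv_mul_gram_le hA hl ht dominate
    (by rw [add_sub_cancel_right]; exact posSemidef_weightedGram hφ hv hv0) S hS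
  have mono := trace_mul_nonneg_of_posSemidef hA.inv.posSemidef
    (posSemidef_smul_weightedGram_sub (c := δ) hφ (continuousOn_const (c := 1)) hw
      fun s hs => by simpa using hwδ s hs)
  rw [Matrix.mul_sub, trace_sub, sub_nonneg, Matrix.mul_smul, trace_smul, smul_eq_mul] at mono
  rw [gram_toLp_eq_weightedGram hφ] at bound
  exact mono.trans (by gcongr)

end WeightedGram

/-- The Volterra kernel `(t - s)⁺` of `∫_0^t ∫_0^r dW_s dr = ∫_0^t (t - s) dW_s`. -/
def ramp (t s : ℝ) : ℝ := max (t - s) 0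

section Ramp

theorem continuous_ramp (t : ℝ) : Continuous (ramp t) := by
  unfold ramp; fun_prop

theorem norm_toLp_sq {α : Type*} [MeasurableSpace α] {μ : Measure α} {f : α → ℝ}
    (hf : MemLp f 2 μ) : ‖hf.toLp‖ ^ 2 = ∫ x, f x ^ 2 ∂μ := by
  rw [← real_inner_self_eq_norm_sq, L2.inner_def]
  refine integral_congr_ae ?_
  filter_upwards [hf.coeFn_toLp] with x hx
  simp [hx, sq]

theorem sq_ramp_sub_interpolation_le {a b t θ : ℝ} (hθ0 : 0 ≤ θ) (hθ1 : θ ≤ 1)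
    (hab : a ≤ b) (ht : t = (1 - θ) * a + θ * b) (s : ℝ) :
    (ramp t s - ((1 - θ) * ramp a s + θ * ramp b s)) ^ 2 ≤
      (Icc a b).indicator (fun _ => (b - a) ^ 2) s := by
  have hat : a ≤ t := by nlinarith
  have htb : t ≤ b := by nlinarith
  unfold ramp
  rcases lt_or_ge s a with hsa | has
  · rw [indicator_of_notMem (fun h => hsa.not_ge h.1), max_eq_left (by linarith),
      max_eq_left (by linarith), max_eq_left (by linarith), ht]
    exact le_of_eq (by ring)
  rcases lt_or_ge b s with hbs | hsb
  · rw [indicator_of_notMem (fun h => hbs.not_ge h.2), max_eq_right (by linarith),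
      max_eq_right (by linarith), max_eq_right (by linarith)]
    simp
  · rw [indicator_of_mem (show s ∈ Icc a b from ⟨has, hsb⟩),
      max_eq_right (b := (0 : ℝ)) (a := a - s) (by linarith),
      max_eq_left (b := (0 : ℝ)) (a := b - s) (by linarith)]
    have h0 := le_max_right (t - s) 0
    have h1 : max (t - s) 0 ≤ b - a := max_le (by linarith) (by linarith)
    refine sq_le_sq' ?_ ?_ <;> nlinarith

/-- The element of `L²(0,1]` represented by `ramp t`. -/
noncomputable def rampLp (t : ℝ) : Lp ℝ 2 (volume.restrict (Ioc (0 : ℝ) 1)) :=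
  (memLp_Ioc_of_continuous (continuous_ramp t)).toLp

theorem norm_rampLp_sub_interpolation_sq_le {a b t θ : ℝ} (hθ0 : 0 ≤ θ) (hθ1 : θ ≤ 1)
    (hab : a ≤ b) (ht : t = (1 - θ) * a + θ * b) :
    ‖rampLp t - ((1 - θ) • rampLp a + θ • rampLp b)‖ ^ 2 ≤ (b - a) ^ 3 := by
  simp only [rampLp, ← MemLp.toLp_const_smul, ← MemLp.toLp_add, ← MemLp.toLp_sub, norm_toLp_sq]
  calc _ ≤ ∫ s in Ioc (0 : ℝ) 1, (Icc a b).indicator (fun _ => (b - a) ^ 2) s :=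
        integral_mono_of_nonneg (ae_of_all _ fun s => sq_nonneg _)
          ((integrable_const _).indicator measurableSet_Icc)
          (ae_of_all _ (sq_ramp_sub_interpolation_le hθ0 hθ1 hab ht))
    _ ≤ ∫ s, (Icc a b).indicator (fun _ => (b - a) ^ 2) s :=
        setIntegral_le_integral ((integrable_indicator_iff measurableSet_Icc).2
          (integrableOn_const measure_Icc_lt_top.ne))
          (ae_of_all _ fun s => indicator_nonneg (fun _ _ => sq_nonneg _) _)
    _ = (b - a) ^ 3 := by
        rw [integral_indicator measurableSet_Icc]
        simp [Measure.real, ENNReal.toReal_ofReal (sub_nonneg.2 hab)]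
        ring

theorem exists_mem_span_rampLp {M : ℕ} (hM : 0 < M) {t : ℝ} (ht : t ∈ Icc (0 : ℝ) 1) :
    ∃ p ∈ Submodule.span ℝ (range fun k : Fin (M + 2) => rampLp (k / M)),
      ‖rampLp t - p‖ ^ 2 ≤ ((M : ℝ) ^ 3)⁻¹ := by
  have hM' : (0 : ℝ) < M := by exact_mod_cast hM
  have htM : 0 ≤ t * M := mul_nonneg ht.1 hM'.le
  set k := ⌊t * M⌋₊
  have hk : k ≤ M := Nat.floor_le_of_le (mul_le_of_le_one_left hM'.le ht.2)
  have node (j : ℕ) (hj : j < M + 2) : rampLp (j / M) ∈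
      Submodule.span ℝ (range fun k : Fin (M + 2) => rampLp (k / M)) :=
    Submodule.subset_span ⟨⟨j, hj⟩, rfl⟩
  refine ⟨(1 - (t * M - k)) • rampLp (k / M) + (t * M - k) • rampLp ((k + 1 : ℕ) / M),
    add_mem (Submodule.smul_mem _ _ (node k (by lia)))
      (Submodule.smul_mem _ _ (node (k + 1) (by lia))), ?_⟩
  refine (norm_rampLp_sub_interpolation_sq_le (sub_nonneg.2 (Nat.floor_le htM))
    (by linarith [Nat.lt_floor_add_one (t * M)]) (by gcongr; lia) ?_).trans_eq ?_
  · push_cast; field_simp; ring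
  · push_cast; field_simp; ring

theorem trace_inv_mul_weightedGram_ramp_le {ι : Type*} [Fintype ι] [DecidableEq ι] {x : ι → ℝ}
    (hx : ∀ i, x i ∈ Icc (0 : ℝ) 1) {v w : ℝ → ℝ} (hv : ContinuousOn v (Icc 0 1)) {l δ t : ℝ}
    (hl : 0 < l) (hvl : ∀ s ∈ Icc (0 : ℝ) 1, l ≤ v s) (hw : ContinuousOn w (Icc 0 1))
    (hδ : 0 ≤ δ) (hwδ : ∀ s ∈ Icc (0 : ℝ) 1, w s ≤ δ) (ht : 0 < t) {M : ℕ} (hM : 0 < M) :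
    ((weightedGram (fun i => ramp (x i)) v + t • (1 : Matrix ι ι ℝ))⁻¹ *
        weightedGram (fun i => ramp (x i)) w).trace ≤
      δ * ((M + 2) / l + Fintype.card ι * ((M : ℝ) ^ 3)⁻¹ / t) := by
  have := FiniteDimensional.span_of_finite ℝ (finite_range fun k : Fin (M + 2) => rampLp (k / M))
  refine (trace_inv_mul_weightedGram_le (fun i => continuous_ramp (x i)) hv hl hvl hw hδ hwδ ht _
    fun i => exists_mem_span_rampLp hM (hx i)).trans ?_
  gcongr
  exact_mod_cast (finrank_range_le_card (R := ℝ) _).trans_eq (Fintype.card_fin _)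

/-- `M = ⌈n^{1/4}⌉` balances the dimension of the approximating space against its error. -/
theorem trace_inv_mul_weightedGram_ramp_le_rpow {ι : Type*} [Fintype ι] [DecidableEq ι]
    [Nonempty ι] {x : ι → ℝ} (hx : ∀ i, x i ∈ Icc (0 : ℝ) 1) {v w : ℝ → ℝ}
    (hv : ContinuousOn v (Icc 0 1)) {l δ t : ℝ} (hl : 0 < l) (hvl : ∀ s ∈ Icc (0 : ℝ) 1, l ≤ v s)
    (hw : ContinuousOn w (Icc 0 1)) (hδ : 0 ≤ δ) (hwδ : ∀ s ∈ Icc (0 : ℝ) 1, w s ≤ δ)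
    (ht : 0 < t) :
    ((weightedGram (fun i => ramp (x i)) v + t • (1 : Matrix ι ι ℝ))⁻¹ *
        weightedGram (fun i => ramp (x i)) w).trace ≤
      δ * ((4 / l + t⁻¹) * (Fintype.card ι : ℝ) ^ (1 / 4 : ℝ)) := by
  have hn : (1 : ℝ) ≤ Fintype.card ι := by exact_mod_cast Fintype.card_pos
  set n := Fintype.card ι
  set q := (n : ℝ) ^ (1 / 4 : ℝ)
  have hq : 1 ≤ q := Real.one_le_rpow hn (by norm_num)
  have hqn : n = q ^ 4 := by
    rw [← Real.rpow_natCast, ← Real.rpow_mul (by positivity)]; norm_num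
  have hqM := Nat.le_ceil q
  have hMq := (Nat.ceil_lt_add_one (zero_le_one.trans hq)).le
  have hM : 0 < ⌈q⌉₊ := Nat.ceil_pos.2 (by linarith)
  refine (trace_inv_mul_weightedGram_ramp_le hx hv hl hvl hw hδ hwδ ht hM).trans ?_
  rw [add_mul]
  gcongr
  · rw [div_mul_eq_mul_div]
    gcongr
    linarith
  · change (n : ℝ) * _ / t ≤ _
    rw [hqn, div_eq_inv_mul, ← div_eq_mul_inv]
    gcongr
    rw [div_le_iff₀ (by positivity)]
    calc q ^ 4 = q * q ^ 3 := by ring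
      _ ≤ q * (⌈q⌉₊ : ℝ) ^ 3 := by gcongr

end Ramp

section StepFunctions

/-- The finite linear combination `∑ c_t W_t` with coefficients `c`. -/
noncomputable def brownianComb {Ω : Type*} (W : ℝ≥0 → Ω → ℝ) : (ℝ≥0 →₀ ℝ) →ₗ[ℝ] (Ω → ℝ) :=
  Finsupp.linearCombination ℝ W

/-- The step function `∑ c_t 1_{(0,t]}`, whose Wiener integral is `brownianComb W c`. -/
noncomputable def stepComb : (ℝ≥0 →₀ ℝ) →ₗ[ℝ] (ℝ → ℝ) :=
  Finsupp.linearCombination ℝ fun t : ℝ≥0 => (Ioc (0 : ℝ) t).indicator fun _ => (1 : ℝ)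

theorem stepComb_apply (c : ℝ≥0 →₀ ℝ) :
    stepComb c = fun r => ∑ t ∈ c.support, c t * (Ioc (0 : ℝ) t).indicator (fun _ => 1) r := by
  ext r
  simp [stepComb, Finsupp.linearCombination_apply, Finsupp.sum]

theorem integrableOn_indicator_Ioc_one (t : ℝ≥0) :
    IntegrableOn ((Ioc (0 : ℝ) t).indicator fun _ => (1 : ℝ)) (Ioi 0) := by
  rw [IntegrableOn, integrable_indicator_iff measurableSet_Ioc]
  exact integrableOn_const ((Measure.restrict_apply_le _ _).trans_lt measure_Ioc_lt_top).ne

theorem memLp_stepComb (c : ℝ≥0 →₀ ℝ) : MemLp (stepComb c) 2 (volume.restrict (Ioi 0)) := by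
  rw [stepComb_apply]
  exact memLp_finsetSum _ fun t _ => (memLp_indicator_const 2 measurableSet_Ioc 1
    (Or.inr ((Measure.restrict_apply_le _ _).trans_lt measure_Ioc_lt_top).ne)).const_mul _

theorem stepComb_sq (c : ℝ≥0 →₀ ℝ) (r : ℝ) :
    stepComb c r ^ 2 = ∑ s ∈ c.support, ∑ t ∈ c.support,
      c s * c t * (Ioc (0 : ℝ) (min s t : ℝ≥0)).indicator (fun _ => 1) r := by
  rw [stepComb_apply, sq, Finset.sum_mul_sum]
  refine Finset.sum_congr rfl fun s _ => Finset.sum_congr rfl fun t _ => ?_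
  have inter : Ioc (0 : ℝ) (min s t : ℝ≥0) = Ioc (0 : ℝ) s ∩ Ioc (0 : ℝ) t := by
    rw [Ioc_inter_Ioc]; simp
  rw [inter, ← indicator_indicator]
  by_cases hs : r ∈ Ioc (0 : ℝ) s <;> by_cases ht : r ∈ Ioc (0 : ℝ) t <;> simp [hs, ht]

theorem integral_stepComb_sq (c : ℝ≥0 →₀ ℝ) :
    ∫ r in Ioi (0 : ℝ), stepComb c r ^ 2 =
      ∑ s ∈ c.support, ∑ t ∈ c.support, c s * c t * (min s t : ℝ≥0) := by
  have hint (s t : ℝ≥0) := (integrableOn_indicator_Ioc_one (min s t)).const_mul (c s * c t)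
  simp_rw [stepComb_sq]
  rw [integral_finsetSum _ fun s _ => integrable_finsetSum _ fun t _ => hint s t]
  refine Finset.sum_congr rfl fun s _ => ?_
  rw [integral_finsetSum _ fun t _ => hint s t]
  refine Finset.sum_congr rfl fun t _ => ?_
  rw [integral_const_mul, integral_indicator measurableSet_Ioc,
    Measure.restrict_restrict measurableSet_Ioc, inter_eq_left.2 Ioc_subset_Ioi_self]
  simp

end StepFunctions

section BrownianComb

variable {Ω : Type*} {W : ℝ≥0 → Ω → ℝ}

theorem brownianComb_apply (c : ℝ≥0 →₀ ℝ) :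
    brownianComb W c = fun ω => ∑ t ∈ c.support, c t * W t ω := by
  ext ω
  simp [brownianComb, Finsupp.linearCombination_apply, Finsupp.sum]

variable [MeasurableSpace Ω] {P : Measure Ω}

theorem memLp_brownianComb (hW : IsBrownianReal W P) (c : ℝ≥0 →₀ ℝ) :
    MemLp (brownianComb W c) 2 P := by
  rw [brownianComb_apply]
  exact memLp_finsetSum _ fun t _ => (hW.hasLaw_eval t).hasGaussianLaw.memLp_two.const_mul _

variable [IsProbabilityMeasure P]

theorem map_brownianComb (hW : IsBrownianReal W P) (c : ℝ≥0 →₀ ℝ) :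
    P.map (brownianComb W c) =
      gaussianReal 0 (∫ r in Ioi (0 : ℝ), stepComb c r ^ 2).toNNReal := by
  have gaussian : HasGaussianLaw (brownianComb W c) P := by
    rw [brownianComb_apply]
    exact (hW.isGaussianProcess.smul c).hasGaussianLaw_fun_sum
  rw [gaussian.map_eq_gaussianReal, brownianComb_apply]
  congr 2
  · rw [integral_finsetSum _ fun t _ => (hW.integrable_eval t).const_mul _]
    refine Finset.sum_eq_zero fun t _ => ?_
    rw [integral_const_mul, hW.integral_eval, mul_zero]
  · rw [variance_fun_sum' fun t _ => (hW.hasLaw_eval t).hasGaussianLaw.memLp_two.const_mul _,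
      integral_stepComb_sq]
    refine Finset.sum_congr rfl fun s _ => Finset.sum_congr rfl fun t _ => ?_
    rw [covariance_const_mul_left, covariance_const_mul_right, hW.covariance_eval]
    ring

theorem integral_cexp_brownianComb_add (hW : IsBrownianReal W P) {N : Ω → ℝ}
    (hN : AEMeasurable N P) (hind : IndepFun (fun ω t => W t ω) N P) (c : ℝ≥0 →₀ ℝ) :
    ∫ ω, Complex.exp ((brownianComb W c ω + N ω : ℝ) * Complex.I) ∂P =
      Complex.exp (-((∫ r in Ioi (0 : ℝ), stepComb c r ^ 2 : ℝ) : ℂ) / 2) *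
        ∫ ω, Complex.exp (N ω * Complex.I) ∂P := by
  have hB : AEMeasurable (brownianComb W c) P := (memLp_brownianComb hW c).1.aemeasurable
  have hBN : IndepFun (brownianComb W c) N P := by
    rw [brownianComb_apply]
    exact hind.comp (φ := fun w : ℝ≥0 → ℝ => ∑ t ∈ c.support, c t * w t) (ψ := id)
      (by fun_prop) measurable_id
  have charFun_one {Z : Ω → ℝ} (hZ : AEMeasurable Z P) :
      charFun (P.map Z) 1 = ∫ ω, Complex.exp (Z ω * Complex.I) ∂P := by
    rw [charFun_apply_real, integral_map hZ (by fun_prop)]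
    simp
  refine (charFun_one (hB.add hN)).symm.trans ?_
  rw [hBN.charFun_map_add_eq_mul hB hN, Pi.mul_apply, charFun_one hN, map_brownianComb hW,
    charFun_gaussianReal]
  congr 2
  rw [Real.coe_toNNReal _ (integral_nonneg fun _ => sq_nonneg _)]
  push_cast; ring

theorem integral_cexp_add_of_tendsto {N Z : Ω → ℝ} (hN : AEMeasurable N P) {Zs : ℕ → Ω → ℝ}
    (hZs : ∀ k, AEMeasurable (Zs k) P)
    (hlim : ∀ᵐ ω ∂P, Tendsto (fun k => Zs k ω) atTop (𝓝 (Z ω))) {q : ℝ} {qs : ℕ → ℝ}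
    (hqs : Tendsto qs atTop (𝓝 q))
    (h : ∀ k, ∫ ω, Complex.exp ((Zs k ω + N ω : ℝ) * Complex.I) ∂P =
      Complex.exp (-(qs k : ℂ) / 2) * ∫ ω, Complex.exp (N ω * Complex.I) ∂P) :
    ∫ ω, Complex.exp ((Z ω + N ω : ℝ) * Complex.I) ∂P =
      Complex.exp (-(q : ℂ) / 2) * ∫ ω, Complex.exp (N ω * Complex.I) ∂P := by
  refine tendsto_nhds_unique (tendsto_integral_of_dominated_convergence (fun _ => 1) (fun k => ?_)
    (integrable_const _) (fun k => ae_of_all _ fun ω => ?_) ?_)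
    (Tendsto.congr (fun k => (h k).symm) ?_)
  · have := hZs k
    exact AEMeasurable.aestronglyMeasurable (by fun_prop)
  · rw [Complex.norm_exp_ofReal_mul_I]
  · filter_upwards [hlim] with ω hω
    have hc : Continuous fun x : ℝ => Complex.exp ((x + N ω : ℝ) * Complex.I) := by fun_prop
    exact (hc.tendsto _).comp hω
  · have hc : Continuous fun x : ℝ => Complex.exp (-(x : ℂ) / 2) *
      ∫ ω, Complex.exp (N ω * Complex.I) ∂P := by fun_prop
    exact (hc.tendsto _).comp hqs

end BrownianComb

/-- `Z = ∫ f dW` for a deterministic square integrable function `f` on the half line. Simultaneous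
approximation by elementary integrals makes the pairs `(Z, f)` a linear space, whatever the
supports of the functions `f`. -/
structure IsWienerPair {Ω : Type*} [MeasurableSpace Ω] (P : Measure Ω) (W : ℝ≥0 → Ω → ℝ)
    (Z : Ω → ℝ) (f : ℝ → ℝ) : Prop where
  memLp_left : MemLp Z 2 P
  memLp_right : MemLp f 2 (volume.restrict (Ioi 0))
  approx : ∀ δ : ℝ≥0∞, 0 < δ → ∃ c : ℝ≥0 →₀ ℝ, eLpNorm (Z - brownianComb W c) 2 P ≤ δ ∧
    eLpNorm (f - stepComb c) 2 (volume.restrict (Ioi 0)) ≤ δ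

namespace IsWienerPair

variable {Ω : Type*} [MeasurableSpace Ω] {P : Measure Ω} {W : ℝ≥0 → Ω → ℝ} {Z Z' : Ω → ℝ}
  {f f' : ℝ → ℝ}

theorem zero : IsWienerPair P W 0 0 where
  memLp_left := MemLp.zero
  memLp_right := MemLp.zero
  approx δ _ := ⟨0, by simp, by simp⟩

theorem const_smul (h : IsWienerPair P W Z f) (a : ℝ) : IsWienerPair P W (a • Z) (a • f) where
  memLp_left := h.memLp_left.const_smul a
  memLp_right := h.memLp_right.const_smul a
  approx δ hδ := by
    obtain ⟨c, hZ, hf⟩ := h.approx (δ / (‖a‖ₑ + 1)) (ENNReal.div_pos hδ.ne' (by simp))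
    have hle : ‖a‖ₑ * (δ / (‖a‖ₑ + 1)) ≤ δ :=
      (mul_le_mul_left (le_add_of_nonneg_right zero_le) _).trans ENNReal.mul_div_le
    refine ⟨a • c, ?_, ?_⟩
    · rw [map_smul, ← smul_sub, eLpNorm_const_smul]
      exact (mul_le_mul_right hZ _).trans hle
    · rw [map_smul, ← smul_sub, eLpNorm_const_smul]
      exact (mul_le_mul_right hf _).trans hle

theorem add (hW : IsBrownianReal W P) (h : IsWienerPair P W Z f) (h' : IsWienerPair P W Z' f') :
    IsWienerPair P W (Z + Z') (f + f') where
  memLp_left := h.memLp_left.add h'.memLp_left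
  memLp_right := h.memLp_right.add h'.memLp_right
  approx δ hδ := by
    obtain ⟨c, hZ, hf⟩ := h.approx _ (ENNReal.half_pos hδ.ne')
    obtain ⟨c', hZ', hf'⟩ := h'.approx _ (ENNReal.half_pos hδ.ne')
    refine ⟨c + c', ?_, ?_⟩
    · rw [map_add, add_sub_add_comm, ← ENNReal.add_halves δ]
      exact (eLpNorm_add_le (h.memLp_left.1.sub (memLp_brownianComb hW c).1)
        (h'.memLp_left.1.sub (memLp_brownianComb hW c').1) one_le_two).trans (add_le_add hZ hZ')
    · rw [map_add, add_sub_add_comm, ← ENNReal.add_halves δ]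
      exact (eLpNorm_add_le (h.memLp_right.1.sub (memLp_stepComb c).1)
        (h'.memLp_right.1.sub (memLp_stepComb c').1) one_le_two).trans (add_le_add hf hf')

theorem sum (hW : IsBrownianReal W P) {ι : Type*} (s : Finset ι) {Z : ι → Ω → ℝ}
    {f : ι → ℝ → ℝ} (h : ∀ i ∈ s, IsWienerPair P W (Z i) (f i)) :
    IsWienerPair P W (∑ i ∈ s, Z i) (∑ i ∈ s, f i) := by
  classical
  induction s using Finset.induction_on with
  | empty => simpa using zero
  | insert i s hi ih =>
    rw [Finset.sum_insert hi, Finset.sum_insert hi]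
    exact (h i (Finset.mem_insert_self _ _)).add hW
      (ih fun j hj => h j (Finset.mem_insert_of_mem hj))

theorem integral_cexp_add [IsProbabilityMeasure P] (hW : IsBrownianReal W P) {N : Ω → ℝ}
    (h : IsWienerPair P W Z f)
    (hN : AEMeasurable N P) (hind : IndepFun (fun ω t => W t ω) N P) :
    ∫ ω, Complex.exp ((Z ω + N ω : ℝ) * Complex.I) ∂P =
      Complex.exp (-((∫ r in Ioi (0 : ℝ), f r ^ 2 : ℝ) : ℂ) / 2) *
        ∫ ω, Complex.exp (N ω * Complex.I) ∂P := by
  choose c hcZ hcf using fun k : ℕ => h.approx (k : ℝ≥0∞)⁻¹ (by simp)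
  have squeeze {x : ℕ → ℝ≥0∞} (hx : ∀ k, x k ≤ (k : ℝ≥0∞)⁻¹) : Tendsto x atTop (𝓝 0) :=
    tendsto_of_tendsto_of_tendsto_of_le_of_le tendsto_const_nhds
      ENNReal.tendsto_inv_nat_nhds_zero (fun _ => zero_le) hx
  have tendsto_Z : Tendsto (fun k => eLpNorm (brownianComb W (c k) - Z) 2 P) atTop (𝓝 0) :=
    squeeze fun k => (eLpNorm_sub_comm _ _ _ _).trans_le (hcZ k)
  have tendsto_f : Tendsto (fun k => eLpNorm (stepComb (c k) - f) 2 (volume.restrict (Ioi 0)))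
      atTop (𝓝 0) :=
    squeeze fun k => (eLpNorm_sub_comm _ _ _ _).trans_le (hcf k)
  have tendsto_sq : Tendsto (fun k => ∫ r in Ioi (0 : ℝ), stepComb (c k) r ^ 2) atTop
      (𝓝 (∫ r in Ioi (0 : ℝ), f r ^ 2)) := by
    simpa only [norm_toLp_sq] using ((Lp.tendsto_Lp_iff_tendsto_eLpNorm'' _
      (fun k => memLp_stepComb (c k)) _ h.memLp_right).2 tendsto_f).norm.pow 2
  obtain ⟨ns, hns, hae⟩ := (tendstoInMeasure_of_tendsto_eLpNorm two_ne_zero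
    (fun k => (memLp_brownianComb hW (c k)).1) h.memLp_left.1 tendsto_Z).exists_seq_tendsto_ae
  exact integral_cexp_add_of_tendsto hN
    (fun k => (memLp_brownianComb hW (c (ns k))).1.aemeasurable) hae
    (tendsto_sq.comp hns.tendsto_atTop) fun k => integral_cexp_brownianComb_add hW hN hind _

end IsWienerPair

section OfStepFunction

variable {Ω : Type*} {W : ℝ≥0 → Ω → ℝ} {m : ℕ} {s : ℕ → ℝ≥0} {c : ℕ → ℝ}

theorem exists_brownianComb_eq_stepIntegral (hs : Monotone s) :
    ∃ d, brownianComb W d = stepIntegral W m s c ∧ stepComb d = stepFunction m s c := by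
  refine ⟨∑ k ∈ Finset.range m, c k • (Finsupp.single (s (k + 1)) 1 - Finsupp.single (s k) 1),
    ?_, ?_⟩
  · ext ω
    simp [brownianComb, stepIntegral]
  · ext r
    simp only [stepComb, stepFunction, map_sum, map_smul, map_sub,
      Finsupp.linearCombination_single, one_smul, Finset.sum_apply, Pi.smul_apply, Pi.sub_apply,
      smul_eq_mul]
    refine Finset.sum_congr rfl fun k _ => ?_
    have h0 : (0 : ℝ) ≤ s k := (s k).2
    have h1 : (s k : ℝ) ≤ s (k + 1) := by exact_mod_cast hs (Nat.le_succ k)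
    simp only [indicator_apply, mem_Ioc]
    grind

theorem stepFunction_eq_zero {t : ℝ≥0} (hst : ∀ k, s k ≤ t) {r : ℝ} (hr : r ∉ Ioc (0 : ℝ) t) :
    stepFunction m s c r = 0 :=
  Finset.sum_eq_zero fun _ _ => indicator_of_notMem
    (fun hk => hr ⟨(s _).2.trans_lt hk.1, hk.2.trans (by exact_mod_cast hst _)⟩) _

theorem IsWienerIntegral.isWienerPair [MeasurableSpace Ω] {P : Measure Ω} {f : ℝ → ℝ} {t : ℝ≥0}
    {Z : Ω → ℝ} (h : IsWienerIntegral P W f t Z) :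
    IsWienerPair P W Z ((Ioc (0 : ℝ) t).indicator f) := by
  obtain ⟨hf, hZ, happrox⟩ := h
  have restrict_restrict : (volume.restrict (Ioi (0 : ℝ))).restrict (Ioc (0 : ℝ) t) =
      volume.restrict (Ioc (0 : ℝ) t) := by
    rw [Measure.restrict_restrict measurableSet_Ioc, inter_eq_left.2 Ioc_subset_Ioi_self]
  refine ⟨hZ, ?_, fun δ hδ => ?_⟩
  · rwa [memLp_indicator_iff_restrict measurableSet_Ioc, restrict_restrict]
  obtain ⟨m, s, c, hs, hst, hfδ, hZδ⟩ := happrox δ hδ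
  obtain ⟨d, hdW, hd⟩ := exists_brownianComb_eq_stepIntegral (W := W) (m := m) (c := c) hs
  have supported : (Ioc (0 : ℝ) t).indicator f - stepComb d =
      (Ioc (0 : ℝ) t).indicator fun r => f r - stepFunction m s c r := by
    ext r
    rw [hd, Pi.sub_apply]
    by_cases hr : r ∈ Ioc (0 : ℝ) t
    · simp only [indicator_of_mem hr]
    · simp only [indicator_of_notMem hr, stepFunction_eq_zero hst hr, sub_zero]
  refine ⟨d, by rwa [hdW], ?_⟩
  rwa [supported, eLpNorm_indicator_eq_eLpNorm_restrict measurableSet_Ioc, restrict_restrict]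

end OfStepFunction

/-- The Riemann sum of `∫_0^b F` over the right end points of `N + 1` equal cells. -/
noncomputable def rightRiemannSum (b : ℝ) (N : ℕ) (F : ℝ → ℝ) : ℝ :=
  ∑ r ∈ Finset.range (N + 1), b / (N + 1) * F (b * (r + 1) / (N + 1))

section RiemannSum

variable {b : ℝ} {N : ℕ}

theorem riemannNode_mem_Icc (hb : 0 ≤ b) {r : ℕ} (hr : r ∈ Finset.range (N + 1)) :
    b * (r + 1) / (N + 1) ∈ Icc 0 b := by
  have hr' : (r : ℝ) + 1 ≤ N + 1 := by exact_mod_cast Finset.mem_range.1 hr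
  refine ⟨by positivity, ?_⟩
  rw [div_le_iff₀ (by positivity)]
  gcongr

theorem rightRiemannSum_congr (hb : 0 ≤ b) {F G : ℝ → ℝ} (h : EqOn F G (Icc 0 b)) :
    rightRiemannSum b N F = rightRiemannSum b N G :=
  Finset.sum_congr rfl fun _ hr => by rw [h (riemannNode_mem_Icc hb hr)]

theorem abs_rightRiemannSum_le (hb : 0 ≤ b) {F : ℝ → ℝ} {C : ℝ} (hC : ∀ x, |F x| ≤ C) :
    |rightRiemannSum b N F| ≤ b * C := by
  refine (Finset.abs_sum_le_sum_abs _ _).trans ?_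
  calc _ ≤ ∑ r ∈ Finset.range (N + 1), b / (N + 1) * C := by
        refine Finset.sum_le_sum fun r _ => ?_
        rw [abs_mul, abs_of_nonneg (by positivity : 0 ≤ b / ((N : ℝ) + 1))]
        gcongr
        exact hC _
    _ = b * C := by
        rw [Finset.sum_const, Finset.card_range, nsmul_eq_mul]
        push_cast
        field_simp

theorem measurable_comp_ceil {F : ℝ → ℝ} (hF : Measurable F) (M : ℝ) :
    Measurable fun x => F (⌈x * M⌉ / M) :=
  hF.comp ((measurable_from_top.comp
    (Int.measurable_ceil.comp (measurable_id.mul_const M))).div_const M)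

theorem intervalIntegrable_comp_ceil {F : ℝ → ℝ} (hF : Measurable F) {C : ℝ}
    (hC : ∀ x, |F x| ≤ C) (M a c : ℝ) :
    IntervalIntegrable (fun x => F (⌈x * M⌉ / M)) volume a c :=
  (intervalIntegrable_const (c := C)).mono_fun (measurable_comp_ceil hF M).aestronglyMeasurable
    (ae_of_all _ fun _ => (hC _).trans (le_abs_self C))

theorem integral_comp_ceil_cell (F : ℝ → ℝ) {M : ℝ} (hM : 0 < M) (r : ℕ) :
    ∫ x in (r : ℝ) / M..((r + 1 : ℕ) : ℝ) / M, F (⌈x * M⌉ / M) = M⁻¹ * F ((r + 1) / M) := by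
  have hle : (r : ℝ) / M ≤ ((r + 1 : ℕ) : ℝ) / M := by gcongr; simp
  have constant : EqOn (fun x => F (⌈x * M⌉ / M)) (fun _ => F ((r + 1) / M))
      (Ioc (r / M) (((r + 1 : ℕ) : ℝ) / M)) := by
    intro x hx
    have ceil : ⌈x * M⌉ = (r : ℤ) + 1 := by
      rw [Int.ceil_eq_iff]
      have h1 := (div_lt_iff₀ hM).1 hx.1
      have h2 := (le_div_iff₀ hM).1 hx.2
      push_cast at h2 ⊢
      constructor <;> linarith
    simp only [ceil, Int.cast_add, Int.cast_natCast, Int.cast_one]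
  rw [intervalIntegral.integral_of_le hle, setIntegral_congr_fun measurableSet_Ioc constant,
    ← intervalIntegral.integral_of_le hle, intervalIntegral.integral_const, smul_eq_mul]
  congr 1
  push_cast
  field_simp
  ring

theorem rightRiemannSum_eq_integral_comp_ceil (hb : 0 < b) (N : ℕ) {F : ℝ → ℝ}
    (hF : Measurable F) {C : ℝ} (hC : ∀ x, |F x| ≤ C) :
    rightRiemannSum b N F = ∫ x in (0 : ℝ)..b, F (⌈x * ((N + 1) / b)⌉ / ((N + 1) / b)) := by
  have hM : 0 < (N + 1) / b := by positivity
  have cells := intervalIntegral.sum_integral_adjacent_intervals (n := N + 1) (μ := volume)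
    (a := fun r : ℕ => (r : ℝ) / ((N + 1) / b)) fun k _ =>
      intervalIntegrable_comp_ceil hF hC ((N + 1) / b) _ _
  have last : ((N + 1 : ℕ) : ℝ) / ((N + 1) / b) = b := by push_cast; field_simp
  simp only [last, Nat.cast_zero, zero_div] at cells
  rw [← cells]
  refine Finset.sum_congr rfl fun r _ => ?_
  rw [integral_comp_ceil_cell F hM, inv_div, div_div_eq_mul_div, mul_comm b]

theorem tendsto_ceil_mul_div (x : ℝ) {M : ℕ → ℝ} (hM : Tendsto M atTop atTop) :
    Tendsto (fun N => (⌈x * M N⌉ : ℝ) / M N) atTop (𝓝 x) := by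
  have upper : Tendsto (fun N => x + (M N)⁻¹) atTop (𝓝 x) := by
    simpa using hM.inv_tendsto_atTop.const_add x
  refine tendsto_of_tendsto_of_tendsto_of_le_of_le' tendsto_const_nhds upper ?_ ?_
  · filter_upwards [hM.eventually_gt_atTop 0] with N hN
    exact (le_div_iff₀ hN).2 (Int.le_ceil _)
  · filter_upwards [hM.eventually_gt_atTop 0] with N hN
    rw [div_le_iff₀ hN, add_mul, inv_mul_cancel₀ hN.ne']
    exact (Int.ceil_lt_add_one _).le

theorem tendsto_rightRiemannSum (hb : 0 < b) {F : ℝ → ℝ} (hF : Measurable F) {C : ℝ}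
    (hC : ∀ x, |F x| ≤ C) (hcont : ∀ᵐ x, ContinuousAt F x) :
    Tendsto (fun N => rightRiemannSum b N F) atTop (𝓝 (∫ x in (0 : ℝ)..b, F x)) := by
  simp_rw [rightRiemannSum_eq_integral_comp_ceil hb _ hF hC]
  refine intervalIntegral.tendsto_integral_filter_of_dominated_convergence (fun _ => C)
    (Eventually.of_forall fun N => (measurable_comp_ceil hF _).aestronglyMeasurable)
    (Eventually.of_forall fun N => ae_of_all _ fun x _ => hC _) intervalIntegrable_const ?_
  filter_upwards [hcont] with x hx _
  refine hx.tendsto.comp (tendsto_ceil_mul_div x (Tendsto.atTop_div_const hb ?_))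
  exact tendsto_atTop_add_const_right _ _ tendsto_natCast_atTop_atTop

theorem tendsto_rightRiemannSum_toNNReal (hb : b ∈ Ioc (0 : ℝ) 1) {x : ℝ≥0 → ℝ}
    (hx : ContinuousOn x (Icc 0 1)) :
    Tendsto (fun N => rightRiemannSum b N fun s => x s.toNNReal) atTop
      (𝓝 (∫ s in (0 : ℝ)..b, x s.toNNReal)) := by
  have stopped_continuous : Continuous fun s : ℝ => x (min s.toNNReal 1) :=
    hx.comp_continuous (by fun_prop) fun s => ⟨zero_le, min_le_right _ _⟩
  have stopped_eq : EqOn (fun s : ℝ => x (min s.toNNReal 1)) (fun s => x s.toNNReal) (Icc 0 b) :=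
    fun s hs => by
      simp only [min_eq_left (Real.toNNReal_le_one.2 (hs.2.trans hb.2))]
  obtain ⟨C, hC⟩ := isCompact_Icc.exists_bound_of_continuousOn hx
  have h := tendsto_rightRiemannSum hb.1 stopped_continuous.measurable
    (fun s => hC _ ⟨zero_le, min_le_right _ _⟩)
    (ae_of_all _ fun s => stopped_continuous.continuousAt)
  rw [intervalIntegral.integral_congr (by rwa [uIcc_of_le hb.1.le])] at h
  exact h.congr fun N => rightRiemannSum_congr hb.1.le stopped_eq

theorem integral_indicator_Ici {s : ℝ} (hs : 0 < s) (hb : 0 ≤ b) :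
    ∫ x in (0 : ℝ)..b, (Ici s).indicator (fun _ => (1 : ℝ)) x = ramp b s := by
  have inter : Ici s ∩ Ioc 0 b = Icc s b := by
    ext x
    simp only [mem_inter_iff, mem_Ici, mem_Ioc, mem_Icc]
    grind
  rw [intervalIntegral.integral_of_le hb, integral_indicator measurableSet_Ici,
    Measure.restrict_restrict measurableSet_Ici, inter]
  simp [ramp, Measure.real, ENNReal.toReal_ofReal']

theorem abs_indicator_one_le (A : Set ℝ) (x : ℝ) : |A.indicator (fun _ => (1 : ℝ)) x| ≤ 1 := by
  rw [abs_of_nonneg (indicator_nonneg (fun _ _ => zero_le_one) _)]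
  exact indicator_le_self' (fun _ _ => zero_le_one) _

theorem tendsto_rightRiemannSum_indicator_Ici (hb : 0 < b) {s : ℝ} (hs : 0 < s) :
    Tendsto (fun N => rightRiemannSum b N ((Ici s).indicator fun _ => 1)) atTop
      (𝓝 (ramp b s)) := by
  rw [← integral_indicator_Ici hs hb.le]
  refine tendsto_rightRiemannSum hb (measurable_const.indicator measurableSet_Ici)
    (abs_indicator_one_le _) ?_
  filter_upwards [volume.ae_ne s] with x hx
  exact continuousOn_const.continuousAt_indicator (by simpa using hx)

theorem measurable_rightRiemannSum_indicator_Ici (b : ℝ) (N : ℕ) :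
    Measurable fun s => rightRiemannSum b N ((Ici s).indicator fun _ => 1) := by
  have swap (s t : ℝ) : (Ici s).indicator (fun _ => (1 : ℝ)) t =
      (Iic t).indicator (fun _ => (1 : ℝ)) s := rfl
  simp only [rightRiemannSum, swap]
  exact Finset.measurable_fun_sum _ fun r _ =>
    (measurable_const.indicator measurableSet_Iic).const_mul _

theorem rightRiemannSum_indicator_Ioc (hb : b ∈ Ioc (0 : ℝ) 1) (σ : ℝ → ℝ) (s : ℝ) :
    (rightRiemannSum b N fun t => (Ioc 0 t).indicator σ s) =
      (Ioc 0 1).indicator (fun r => σ r * rightRiemannSum b N ((Ici r).indicator fun _ => 1))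
        s := by
  have factor : ∀ t ∈ Icc 0 b, (Ioc 0 t).indicator σ s =
      (Ioc 0 1).indicator σ s * (Ici s).indicator (fun _ => 1) t := by
    intro t ht
    have := ht.2.trans hb.2
    simp only [indicator_apply, mem_Ioc, mem_Ici]
    grind
  have pull_out (c : ℝ) (F : ℝ → ℝ) :
      rightRiemannSum b N (fun t => c * F t) = c * rightRiemannSum b N F := by
    simp only [rightRiemannSum, mul_left_comm _ c, Finset.mul_sum]
  rw [rightRiemannSum_congr hb.1.le factor, pull_out, indicator_mul_left]

end RiemannSum

section IntegratedProcess

variable {Ω : Type*} [MeasurableSpace Ω] {P : Measure Ω} {W : ℝ≥0 → Ω → ℝ} {σ : ℝ → ℝ}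
  {X : ℝ≥0 → Ω → ℝ}

theorem IsWienerIntegralProcess.aemeasurable_integral (hX : IsWienerIntegralProcess P W σ X)
    {b : ℝ} (hb : b ∈ Ioc (0 : ℝ) 1) :
    AEMeasurable (fun ω => ∫ s in (0 : ℝ)..b, X s.toNNReal ω) P := by
  refine aemeasurable_of_tendsto_metrizable_ae atTop
    (f := fun N ω => rightRiemannSum b N fun s => X s.toNNReal ω) (fun N => ?_) ?_
  · refine Finset.aemeasurable_fun_sum _ fun r hr => AEMeasurable.const_mul ?_ _
    exact (hX.isWienerIntegral _ (Real.toNNReal_le_one.2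
      ((riemannNode_mem_Icc hb.1.le hr).2.trans hb.2))).2.1.1.aemeasurable
  · filter_upwards [hX.continuousOn] with ω hω
    exact tendsto_rightRiemannSum_toNNReal hb hω

theorem IsWienerIntegralProcess.isWienerPair_rightRiemannSum
    (hW : IsBrownianReal W P) (hX : IsWienerIntegralProcess P W σ X)
    {b : ℝ} (hb : b ∈ Ioc (0 : ℝ) 1) (N : ℕ) :
    IsWienerPair P W (fun ω => rightRiemannSum b N fun t => X t.toNNReal ω)
      ((Ioc 0 1).indicator fun s => σ s * rightRiemannSum b N ((Ici s).indicator fun _ => 1)) := by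
  have node (r : ℕ) (hr : r ∈ Finset.range (N + 1)) :
      IsWienerPair P W (X (b * (r + 1) / (N + 1)).toNNReal)
        ((Ioc 0 (b * (r + 1) / (N + 1))).indicator σ) := by
    have hmem := riemannNode_mem_Icc hb.1.le hr
    simpa only [Real.coe_toNNReal _ hmem.1] using (hX.isWienerIntegral _
      (Real.toNNReal_le_one.2 (hmem.2.trans hb.2))).isWienerPair
  convert IsWienerPair.sum hW _ fun r hr => (node r hr).const_smul (b / (N + 1)) using 1
  · ext ω
    simp only [rightRiemannSum, Finset.sum_apply, Pi.smul_apply, smul_eq_mul]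
  · ext s
    rw [← rightRiemannSum_indicator_Ioc hb]
    simp only [rightRiemannSum, Finset.sum_apply, Pi.smul_apply, smul_eq_mul]

variable {ι : Type*} [Fintype ι] {x : ι → ℝ}

theorem IsWienerIntegralProcess.isWienerPair_sum_rightRiemannSum
    (hW : IsBrownianReal W P) (hX : IsWienerIntegralProcess P W σ X)
    (hx : ∀ i, x i ∈ Ioc (0 : ℝ) 1) (u : ι → ℝ) (N : ℕ) :
    IsWienerPair P W (fun ω => ∑ i, u i * rightRiemannSum (x i) N fun t => X t.toNNReal ω)
      ((Ioc 0 1).indicator fun s =>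
        σ s * ∑ i, u i * rightRiemannSum (x i) N ((Ici s).indicator fun _ => 1)) := by
  convert IsWienerPair.sum hW Finset.univ fun i _ =>
    (hX.isWienerPair_rightRiemannSum hW (hx i) N).const_smul (u i) using 1
  · ext ω
    simp only [Finset.sum_apply, Pi.smul_apply, smul_eq_mul]
  · ext s
    simp only [Finset.sum_apply, Pi.smul_apply, smul_eq_mul, indicator_apply, mul_ite, mul_zero,
      Finset.mul_sum, mul_left_comm (σ s)]
    split_ifs <;> simp

theorem tendsto_integral_sq_sum_rightRiemannSum (hσ : ContinuousOn σ (Icc 0 1))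
    (hx : ∀ i, x i ∈ Ioc (0 : ℝ) 1) (u : ι → ℝ) :
    Tendsto (fun N => ∫ s in Ioc (0 : ℝ) 1,
        (σ s * ∑ i, u i * rightRiemannSum (x i) N ((Ici s).indicator fun _ => 1)) ^ 2) atTop
      (𝓝 (∫ s in Ioc (0 : ℝ) 1, (σ s * ∑ i, u i * ramp (x i) s) ^ 2)) := by
  obtain ⟨B, hB⟩ := isCompact_Icc.exists_bound_of_continuousOn hσ
  have sum_le (N : ℕ) (s : ℝ) :
      |∑ i, u i * rightRiemannSum (x i) N ((Ici s).indicator fun _ => 1)| ≤ ∑ i, |u i| := by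
    refine (Finset.abs_sum_le_sum_abs _ _).trans (Finset.sum_le_sum fun i _ => ?_)
    rw [abs_mul]
    refine mul_le_of_le_one_right (abs_nonneg _) ?_
    exact (abs_rightRiemannSum_le (hx i).1.le (abs_indicator_one_le _)).trans
      ((mul_one _).trans_le (hx i).2)
  refine tendsto_integral_of_dominated_convergence (fun _ => (B * ∑ i, |u i|) ^ 2) (fun N => ?_)
    (integrable_const _) (fun N => ?_) ?_
  · have hσm := (hσ.mono Ioc_subset_Icc_self).aestronglyMeasurable (μ := volume) measurableSet_Ioc
    exact (hσm.mul (Finset.measurable_fun_sum _ fun i _ =>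
      (measurable_rightRiemannSum_indicator_Ici (x i) N).const_mul _).aestronglyMeasurable).pow 2
  · refine (ae_restrict_iff' measurableSet_Ioc).2 (ae_of_all _ fun s hs => ?_)
    have hσB : |σ s| ≤ B := hB s ⟨hs.1.le, hs.2⟩
    rw [Real.norm_eq_abs, abs_pow, abs_mul]
    gcongr
    exacts [(abs_nonneg _).trans hσB, sum_le N s]
  · refine (ae_restrict_iff' measurableSet_Ioc).2 (ae_of_all _ fun s hs => ?_)
    exact ((tendsto_finsetSum _ fun i _ => (tendsto_rightRiemannSum_indicator_Ici (hx i).1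
      hs.1).const_mul (u i)).const_mul (σ s)).pow 2

/-- Stochastic Fubini: `∑ u_i ∫_0^{x_i} X_s ds` is the Wiener integral of `σ ∑ u_i (x_i - s)⁺`. -/
theorem IsWienerIntegralProcess.integral_cexp_add [IsProbabilityMeasure P]
    (hW : IsBrownianReal W P) (hσ : ContinuousOn σ (Icc 0 1))
    (hX : IsWienerIntegralProcess P W σ X) (hx : ∀ i, x i ∈ Ioc (0 : ℝ) 1) {N : Ω → ℝ}
    (hN : AEMeasurable N P) (hind : IndepFun (fun ω t => W t ω) N P) (u : ι → ℝ) :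
    ∫ ω, Complex.exp ((∑ i, u i * (∫ s in (0 : ℝ)..x i, X s.toNNReal ω) + N ω : ℝ) *
        Complex.I) ∂P =
      Complex.exp (-((∫ s in (0 : ℝ)..1, (σ s * ∑ i, u i * ramp (x i) s) ^ 2 : ℝ) : ℂ) / 2) *
        ∫ ω, Complex.exp (N ω * Complex.I) ∂P := by
  have pair := hX.isWienerPair_sum_rightRiemannSum hW hx u
  rw [intervalIntegral.integral_of_le zero_le_one]
  refine integral_cexp_add_of_tendsto hN (fun k => (pair k).memLp_left.1.aemeasurable) ?_
    (tendsto_integral_sq_sum_rightRiemannSum hσ hx u) fun k => ?_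
  · filter_upwards [hX.continuousOn] with ω hω
    exact tendsto_finsetSum _ fun i _ =>
      (tendsto_rightRiemannSum_toNNReal (hx i) hω).const_mul (u i)
  · have indicator_sq (g : ℝ → ℝ) (s : ℝ) :
        (Ioc (0 : ℝ) 1).indicator g s ^ 2 = (Ioc 0 1).indicator (fun r => g r ^ 2) s := by
      by_cases hs : s ∈ Ioc (0 : ℝ) 1 <;> simp [hs]
    have inter : Ioc (0 : ℝ) 1 ∩ Ioi 0 = Ioc 0 1 := inter_eq_left.2 Ioc_subset_Ioi_self
    simp only [(pair k).integral_cexp_add hW hN hind, indicator_sq,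
      integral_indicator measurableSet_Ioc, Measure.restrict_restrict measurableSet_Ioc, inter]

end IntegratedProcess

section Observation

open Matrix WithLp
open scoped RealInnerProductSpace

/-- The observation times `i / n`, `i = 1, …, n`, in the indexing of `integratedObservation`. -/
noncomputable def observationTime (n : ℕ) (i : Fin n) : ℝ :=
  ((i : ℝ) + 1) / n

/-- The covariance matrix of the observation vector when the squared volatility is `v`. -/
noncomputable def observationCov (τ : ℝ) (n : ℕ) (v : ℝ → ℝ) : Matrix (Fin n) (Fin n) ℝ :=
  weightedGram (fun i => ramp (observationTime n i)) v + τ ^ 2 • (1 : Matrix (Fin n) (Fin n) ℝ)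

theorem observationTime_mem_Ioc {n : ℕ} (i : Fin n) : observationTime n i ∈ Ioc (0 : ℝ) 1 := by
  have hn : 0 < n := i.pos
  have hi : ((i : ℕ) : ℝ) + 1 ≤ n := by exact_mod_cast i.2
  refine ⟨by unfold observationTime; positivity, ?_⟩
  rw [observationTime, div_le_one (by positivity)]
  exact hi

variable {Ω : Type*} [MeasurableSpace Ω] {P : Measure Ω} {W : ℝ≥0 → Ω → ℝ}
  {ε : (n : ℕ) → Fin n → Ω → ℝ} {X : (ℝ → ℝ) → ℝ≥0 → Ω → ℝ} {τ : ℝ} {n : ℕ} {v h : ℝ → ℝ}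

theorem integral_cexp_sum_mul_of_iIndepFun_gaussian {ι : Type*} [Fintype ι] {e : ι → Ω → ℝ}
    (hlaw : ∀ i, HasLaw (e i) (gaussianReal 0 1) P) (hind : iIndepFun e P) (u : ι → ℝ) :
    ∫ ω, Complex.exp ((∑ i, u i * e i ω : ℝ) * Complex.I) ∂P =
      Complex.exp (-(∑ i, (u i : ℂ) ^ 2) / 2) := by
  have hpi := hind.hasLaw_pi hlaw
  have h := charFun_pi (μ := fun _ : ι => gaussianReal 0 1) (t := toLp 2 u)
  simp only [charFun_gaussianReal, ← Complex.exp_sum] at h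
  rw [charFun_apply, ← hpi.map_eq, integral_map (by fun_prop) (by fun_prop),
    integral_map hpi.aemeasurable (by fun_prop)] at h
  simp only [EuclideanSpace.inner_eq_star_dotProduct, star_trivial, dotProduct] at h
  refine h.trans (congrArg _ ?_)
  simp [Finset.sum_neg_distrib, neg_div, Finset.sum_div]

theorem IsNoisyVolatilityModel.process_sqrt (hM : IsNoisyVolatilityModel P W ε X)
    (hv : ContinuousOn v (Icc 0 1)) (hv0 : ∀ s ∈ Icc (0 : ℝ) 1, 0 < v s) :
    IsWienerIntegralProcess P W (fun s => √(v s)) (X fun s => √(v s)) :=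
  hM.process _ hv.sqrt fun s hs => Real.sqrt_pos.2 (hv0 s hs)

theorem IsNoisyVolatilityModel.aemeasurable_observation (hM : IsNoisyVolatilityModel P W ε X)
    (hv : ContinuousOn v (Icc 0 1)) (hv0 : ∀ s ∈ Icc (0 : ℝ) 1, 0 < v s) :
    AEMeasurable (integratedObservation τ n (X fun s => √(v s)) (ε n)) P :=
  aemeasurable_pi_lambda _ fun i =>
    ((hM.process_sqrt hv hv0).aemeasurable_integral (observationTime_mem_Ioc i)).add
      ((hM.noise_law n i).aemeasurable.const_mul τ)

variable [IsProbabilityMeasure P]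

theorem IsNoisyVolatilityModel.integral_cexp_observation (hM : IsNoisyVolatilityModel P W ε X)
    (hv : ContinuousOn v (Icc 0 1)) (hv0 : ∀ s ∈ Icc (0 : ℝ) 1, 0 < v s) (u : Fin n → ℝ) :
    ∫ ω, Complex.exp ((∑ i, u i * integratedObservation τ n (X fun s => √(v s)) (ε n) ω i : ℝ) *
        Complex.I) ∂P = Complex.exp (-((u ⬝ᵥ observationCov τ n v *ᵥ u : ℝ) : ℂ) / 2) := by
  have hε (i) : AEMeasurable (ε n i) P := (hM.noise_law n i).aemeasurable
  have split (ω : Ω) : ∑ i, u i * integratedObservation τ n (X fun s => √(v s)) (ε n) ω i =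
      ∑ i, u i * (∫ s in (0 : ℝ)..observationTime n i, X (fun s => √(v s)) s.toNNReal ω) +
        ∑ i, (u i * τ) * ε n i ω := by
    simp only [integratedObservation, observationTime, mul_add, Finset.sum_add_distrib, mul_assoc]
  have noise_indep : IndepFun (fun ω t => W t ω) (fun ω => ∑ i, (u i * τ) * ε n i ω) P :=
    (hM.indep n).comp (φ := id) (ψ := fun e : Fin n → ℝ => ∑ i, (u i * τ) * e i) measurable_id
      (by fun_prop)
  have signal_var : ∫ s in (0 : ℝ)..1, (√(v s) * ∑ i, u i * ramp (observationTime n i) s) ^ 2 =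
      u ⬝ᵥ weightedGram (fun i => ramp (observationTime n i)) v *ᵥ u := by
    rw [dotProduct_weightedGram_mulVec (fun i => continuous_ramp _) hv]
    refine intervalIntegral.integral_congr fun s hs => ?_
    rw [uIcc_of_le zero_le_one] at hs
    simp only [mul_pow, Real.sq_sqrt (hv0 s hs).le]
  have sq_sum : u ⬝ᵥ u = ∑ i, u i ^ 2 := Finset.sum_congr rfl fun i _ => (sq (u i)).symm
  simp_rw [split]
  rw [(hM.process_sqrt hv hv0).integral_cexp_add hM.brownian hv.sqrt observationTime_mem_Ioc
    (by fun_prop) noise_indep, integral_cexp_sum_mul_of_iIndepFun_gaussian (hM.noise_law n)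
    (hM.noise_indep n), ← Complex.exp_add, signal_var, observationCov, add_mulVec, dotProduct_add,
    smul_mulVec, one_mulVec, dotProduct_smul, smul_eq_mul,
    sq_sum]
  congr 1
  push_cast
  simp only [mul_pow, ← Finset.sum_mul]
  ring

theorem posDef_observationCov (hτ : τ ≠ 0) (hv : ContinuousOn v (Icc 0 1))
    (hv0 : ∀ s ∈ Icc (0 : ℝ) 1, 0 ≤ v s) : (observationCov τ n v).PosDef :=
  posDef_weightedGram_add_smul_one (fun i => continuous_ramp _) hv hv0 (by positivity)

theorem IsNoisyVolatilityModel.map_observation (hτ : τ ≠ 0) (hM : IsNoisyVolatilityModel P W ε X)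
    (hv : ContinuousOn v (Icc 0 1)) (hv0 : ∀ s ∈ Icc (0 : ℝ) 1, 0 < v s) :
    P.map (fun ω => toLp 2 (integratedObservation τ n (X fun s => √(v s)) (ε n) ω)) =
      multivariateGaussian 0 (observationCov τ n v) := by
  have hY := hM.aemeasurable_observation (τ := τ) (n := n) hv hv0
  have htoLp : AEMeasurable
      (fun ω => toLp 2 (integratedObservation τ n (X fun s => √(v s)) (ε n) ω)) P := by fun_prop
  have := Measure.isProbabilityMeasure_map htoLp
  refine Measure.ext_of_charFun (funext fun u => ?_)
  rw [charFun_multivariateGaussian 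
      (posDef_observationCov hτ hv fun s hs => (hv0 s hs).le).posSemidef, charFun_apply,
    integral_map htoLp (by fun_prop)]
  simp only [EuclideanSpace.inner_eq_star_dotProduct, star_trivial]
  refine (hM.integral_cexp_observation hv hv0 u.ofLp).trans (congrArg _ ?_)
  simp [neg_div]

theorem IsNoisyVolatilityModel.two_point_observation (hτ : τ ≠ 0)
    (hM : IsNoisyVolatilityModel P W ε X) (hv : ContinuousOn v (Icc 0 1))
    (hv0 : ∀ s ∈ Icc (0 : ℝ) 1, 0 < v s) (hh : ContinuousOn h (Icc 0 1))
    (hh0 : ∀ s ∈ Icc (0 : ℝ) 1, 0 ≤ h s) {k : ℝ} (hk : 0 ≤ k)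
    (hhk : ∀ s ∈ Icc (0 : ℝ) 1, h s ≤ k * v s) {f : (Fin n → ℝ) → ℝ} (hf : Measurable f)
    (a b : ℝ) :
    ENNReal.ofReal ((a - b) ^ 2 / 2 * (1 - k / 8 * ((observationCov τ n v)⁻¹ *
        weightedGram (fun i => ramp (observationTime n i)) h).trace)) ≤
      ∫⁻ ω, ENNReal.ofReal
        ((f (integratedObservation τ n (X fun s => √(v s)) (ε n) ω) - a) ^ 2) ∂P +
      ∫⁻ ω, ENNReal.ofReal
        ((f (integratedObservation τ n (X fun s => √(v s + h s)) (ε n) ω) - b) ^ 2) ∂P := by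
  have hφ (i : Fin n) := continuous_ramp (observationTime n i)
  have hv0' (s) (hs : s ∈ Icc (0 : ℝ) 1) : 0 ≤ v s := (hv0 s hs).le
  have hvh : ContinuousOn (fun s => v s + h s) (Icc 0 1) := hv.add hh
  have hvh0 (s) (hs : s ∈ Icc (0 : ℝ) 1) : 0 < v s + h s :=
    add_pos_of_pos_of_nonneg (hv0 s hs) (hh0 s hs)
  have cov_add : observationCov τ n (fun s => v s + h s) =
      observationCov τ n v + weightedGram (fun i => ramp (observationTime n i)) h := by
    rw [observationCov, observationCov, weightedGram_add hφ hv hh, add_right_comm]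
  have dominate : (k • observationCov τ n v -
      weightedGram (fun i => ramp (observationTime n i)) h).PosSemidef := by
    rw [observationCov, smul_add, add_sub_right_comm]
    exact (posSemidef_smul_weightedGram_sub hφ hv hh hhk).add
      ((PosSemidef.one.smul (sq_nonneg τ)).smul hk)
  have hg : Measurable fun y : EuclideanSpace ℝ (Fin n) => f (ofLp y) := by fun_prop
  have bound := two_point_multivariateGaussian (posDef_observationCov hτ hv hv0')
    (posSemidef_weightedGram hφ hh hh0) dominate hg a b
  have hY := hM.aemeasurable_observation (τ := τ) (n := n) hv hv0
  have hY' := hM.aemeasurable_observation (τ := τ) (n := n) hvh hvh0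
  rwa [← cov_add, ← hM.map_observation hτ hv hv0, ← hM.map_observation hτ hvh hvh0,
    lintegral_map' (by fun_prop) (by fun_prop), lintegral_map' (by fun_prop) (by fun_prop)] at bound

end Observation

section Bumps

open scoped ContDiff

theorem holderWith_of_abs_le_of_abs_deriv_le {f : ℝ → ℝ} {B B' β : ℝ≥0} (hf : Differentiable ℝ f)
    (hB : ∀ x, |f x| ≤ B) (hB' : ∀ x, |deriv f x| ≤ B') (hβ : β ≤ 1) :
    HolderWith (max (2 * B) B') β f := by
  have bounded : HolderWith (2 * B) 0 f := fun x y => by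
    rw [edist_dist, NNReal.coe_zero, ENNReal.rpow_zero, mul_one, ← ENNReal.ofReal_coe_nnreal]
    refine ENNReal.ofReal_le_ofReal ((abs_sub _ _).trans ?_)
    rw [NNReal.coe_mul, NNReal.coe_ofNat, two_mul]
    exact add_le_add (hB x) (hB y)
  exact bounded.of_le_of_le (lipschitzWith_of_nnnorm_deriv_le hf hB').holderWith zero_le hβ

theorem iteratedDeriv_dilation {f : ℝ → ℝ} (hf : ContDiff ℝ ∞ f) (l A c : ℝ) {k : ℕ}
    (hk : k ≠ 0) (x : ℝ) :
    iteratedDeriv k (fun x => l + A * f (c * x)) x = A * c ^ k * iteratedDeriv k f (c * x) := by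
  rw [iteratedDeriv_const_add (Nat.pos_of_ne_zero hk), iteratedDeriv_const_mul_field,
    iteratedDeriv_comp_const_mul (hf.of_le (mod_cast le_top)), mul_assoc]

theorem iteratedDeriv_dilation_sub {f : ℝ → ℝ} (hf : ContDiff ℝ ∞ f) (l A c : ℝ) (k : ℕ)
    (x y : ℝ) :
    iteratedDeriv k (fun x => l + A * f (c * x)) x -
        iteratedDeriv k (fun x => l + A * f (c * x)) y =
      A * c ^ k * (iteratedDeriv k f (c * x) - iteratedDeriv k f (c * y)) := by
  rcases eq_or_ne k 0 with rfl | hk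
  · simp only [iteratedDeriv_zero, pow_zero]
    ring
  · rw [iteratedDeriv_dilation hf l A c hk, iteratedDeriv_dilation hf l A c hk, mul_sub]

theorem differentiableOn_iteratedDerivWithin {f : ℝ → ℝ} (hf : ContDiff ℝ ∞ f) (k : ℕ) :
    DifferentiableOn ℝ (iteratedDerivWithin k f (Icc 0 1)) (Icc 0 1) :=
  hf.contDiffOn.differentiableOn_iteratedDerivWithin (mod_cast WithTop.coe_lt_top _)
    (uniqueDiffOn_Icc zero_lt_one)

theorem dilation_mem_holderClass {f : ℝ → ℝ} (hf : ContDiff ℝ ∞ f) {α : ℝ} (hα : 0 ≤ α)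
    {B B' : ℝ≥0} (hB : ∀ x, |iteratedDeriv ⌊α⌋₊ f x| ≤ B)
    (hB' : ∀ x, |iteratedDeriv (⌊α⌋₊ + 1) f x| ≤ B') (hf01 : ∀ x, f x ∈ Icc (0 : ℝ) 1)
    {L l u a c : ℝ} (ha : 0 ≤ a) (hc : 1 ≤ c) (haL : a * max (2 * B) B' ≤ L) (hau : a ≤ u - l) :
    (fun x => l + a * c ^ (-α) * f (c * x)) ∈ holderClass α L l u := by
  have hc0 : 0 < c := zero_lt_one.trans_le hc
  set p := ⌊α⌋₊
  have hβ : 0 ≤ α - p := sub_nonneg.2 (Nat.floor_le hα)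
  have hsmooth : ContDiff ℝ ∞ fun x => l + a * c ^ (-α) * f (c * x) := by fun_prop
  have holder := holderWith_of_abs_le_of_abs_deriv_le (β := (α - p).toNNReal)
    (hf.differentiable_iteratedDeriv p (mod_cast WithTop.coe_lt_top _)) hB
    (by simpa only [iteratedDeriv_succ] using hB')
    (Real.toNNReal_le_one.2 (by linarith [Nat.lt_floor_add_one α]))
  have within (x) (hx : x ∈ Icc (0 : ℝ) 1) := iteratedDerivWithin_eq_iteratedDeriv
    (n := p) (uniqueDiffOn_Icc zero_lt_one) (hsmooth.of_le (mod_cast le_top)).contDiffAt hx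
  have scale : c ^ (-α) * c ^ p * c ^ (α - p) = 1 := by
    rw [← Real.rpow_natCast, ← Real.rpow_add hc0, ← Real.rpow_add hc0, add_assoc,
      add_sub_cancel, neg_add_cancel, Real.rpow_zero]
  have amplitude : a * c ^ (-α) ≤ a :=
    mul_le_of_le_one_right ha (Real.rpow_le_one_of_one_le_of_nonpos hc (neg_nonpos.2 hα))
  refine ⟨fun k _ => differentiableOn_iteratedDerivWithin hsmooth k, fun x hx y hy => ?_,
    fun x _ => ⟨le_add_of_nonneg_right (mul_nonneg (by positivity) (hf01 _).1), ?_⟩⟩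
  · rw [within x hx, within y hy, iteratedDeriv_dilation_sub hf, abs_mul,
      abs_of_nonneg (by positivity)]
    calc _ ≤ a * c ^ (-α) * c ^ p * (max (2 * B) B' * (c * |x - y|) ^ (α - p)) := by
          gcongr
          simpa [Real.dist_eq, Real.coe_toNNReal _ hβ, ← mul_sub, abs_mul, abs_of_pos hc0]
            using holder.dist_le (c * x) (c * y)
      _ = (c ^ (-α) * c ^ p * c ^ (α - p)) * (a * max (2 * B) B') * |x - y| ^ (α - p) := by
          rw [Real.mul_rpow hc0.le (abs_nonneg _)]
          ring
      _ ≤ L * |x - y| ^ (α - p) := by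
          rw [scale, one_mul]
          gcongr
  · linarith [mul_le_of_le_one_right (by positivity : 0 ≤ a * c ^ (-α)) (hf01 (c * x)).2]

/-- A smooth bump with support `(1/4, 3/4)` which is `1` on `[3/8, 5/8]`; its translates by
integers have disjoint supports. -/
noncomputable def unitBump : ContDiffBump (1 / 2 : ℝ) := ⟨1 / 8, 1 / 4, by norm_num, by norm_num⟩

theorem contDiff_unitBump : ContDiff ℝ ∞ unitBump := unitBump.contDiff

theorem iteratedDeriv_unitBump_eq_zero (k : ℕ) {y : ℝ} (hy : y ∉ Icc (1 / 4 : ℝ) (3 / 4)) :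
    iteratedDeriv k unitBump y = 0 := by
  have hy' : y ∉ tsupport unitBump := by
    rw [unitBump.tsupport_eq, Real.closedBall_eq_Icc]
    convert hy using 2
    norm_num [unitBump]
  have fderiv_eq_zero : iteratedFDeriv ℝ k unitBump y = 0 :=
    Function.notMem_support.1 (mt (fun h => support_iteratedFDeriv_subset k h) hy')
  rw [iteratedDeriv_eq_iteratedFDeriv, fderiv_eq_zero]
  rfl

theorem exists_abs_iteratedDeriv_unitBump_le (k : ℕ) :
    ∃ B : ℝ≥0, ∀ y, |iteratedDeriv k unitBump y| ≤ B := by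
  obtain ⟨B, hB⟩ := Continuous.bounded_above_of_compact_support
    (contDiff_unitBump.continuous_iteratedDeriv k (mod_cast le_top))
    (HasCompactSupport.intro isCompact_Icc fun y hy => iteratedDeriv_unitBump_eq_zero k hy)
  exact ⟨⟨B, (norm_nonneg _).trans (hB 0)⟩, hB⟩

theorem abs_sum_translates_le {g : ℝ → ℝ} {B : ℝ} (hg : ∀ y, |g y| ≤ B)
    (h0 : ∀ y, y ∉ Icc (1 / 4 : ℝ) (3 / 4) → g y = 0) {m : ℕ} (s : Finset (Fin m)) (y : ℝ) :
    |∑ j ∈ s, g (y - j)| ≤ B := by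
  by_cases h : ∃ j ∈ s, g (y - j) ≠ 0
  · obtain ⟨j, hj, hne⟩ := h
    have hyj : y - j ∈ Icc (1 / 4 : ℝ) (3 / 4) := by_contra fun hcon => hne (h0 _ hcon)
    rw [Finset.sum_eq_single_of_mem j hj fun i _ hij => h0 _ fun hyi => hij (Fin.ext ?_)]
    · exact hg _
    · have hij' : ((i : ℕ) : ℝ) < (j : ℕ) + 1 := by linarith [hyi.1, hyj.2]
      have hji' : ((j : ℕ) : ℝ) < (i : ℕ) + 1 := by linarith [hyi.2, hyj.1]
      norm_cast at hij' hji'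
      lia
  · push Not at h
    rw [Finset.sum_eq_zero h, abs_zero]
    exact (abs_nonneg _).trans (hg 0)

/-- The sum of the translates of `unitBump` to the unit cells `[j, j + 1]`, `j ∈ s`. -/
noncomputable def bumpTrain {m : ℕ} (s : Finset (Fin m)) (y : ℝ) : ℝ :=
  ∑ j ∈ s, unitBump (y - j)

variable {m : ℕ}

theorem contDiff_bumpTrain (s : Finset (Fin m)) : ContDiff ℝ ∞ (bumpTrain s) :=
  ContDiff.sum fun _ _ => contDiff_unitBump.comp (contDiff_id.sub contDiff_const)

theorem bumpTrain_mem_Icc (s : Finset (Fin m)) (y : ℝ) : bumpTrain s y ∈ Icc (0 : ℝ) 1 := by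
  refine ⟨Finset.sum_nonneg fun _ _ => unitBump.nonneg, (le_abs_self _).trans
    (abs_sum_translates_le (fun y => ?_) (fun y => ?_) s y)⟩
  · rw [abs_of_nonneg unitBump.nonneg]
    exact unitBump.le_one
  · simpa using iteratedDeriv_unitBump_eq_zero 0

theorem abs_iteratedDeriv_bumpTrain_le {k : ℕ} {B : ℝ}
    (hB : ∀ y, |iteratedDeriv k unitBump y| ≤ B) (s : Finset (Fin m)) (y : ℝ) :
    |iteratedDeriv k (bumpTrain s) y| ≤ B := by
  have deriv_eq : iteratedDeriv k (bumpTrain s) y =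
      ∑ j ∈ s, iteratedDeriv k unitBump (y - j) := by
    unfold bumpTrain
    rw [iteratedDeriv_fun_sum fun j _ => by
      exact ((contDiff_unitBump.of_le (mod_cast le_top)).comp
        (contDiff_id.sub contDiff_const)).contDiffAt]
    simp only [iteratedDeriv_comp_sub_const]
  rw [deriv_eq]
  exact abs_sum_translates_le hB (fun _ => iteratedDeriv_unitBump_eq_zero k) s y

/-- The constant `l` perturbed by bumps of height `A` on those cells `[j / m, (j + 1) / m]` of the
regular grid which are selected by `s`: the hypotheses of the lower bound in part (i). -/
noncomputable def bumpFun (l A : ℝ) (s : Finset (Fin m)) (x : ℝ) : ℝ :=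
  l + A * bumpTrain s (m * x)

/-- The bump of height `A` on the `j`-th cell of the grid of mesh `1 / m`. -/
noncomputable def cellBump (A : ℝ) (j : Fin m) (x : ℝ) : ℝ :=
  A * unitBump (m * x - j)

theorem bumpFun_insert (l A : ℝ) {s : Finset (Fin m)} {j : Fin m} (hj : j ∉ s) :
    bumpFun l A (insert j s) = fun x => bumpFun l A s x + cellBump A j x := by
  ext x
  rw [bumpFun, bumpFun, bumpTrain, Finset.sum_insert hj, bumpTrain, cellBump]
  ring

theorem continuous_bumpFun (l A : ℝ) (s : Finset (Fin m)) : Continuous (bumpFun l A s) := by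
  have := (contDiff_bumpTrain s).continuous
  unfold bumpFun
  fun_prop

theorem continuous_cellBump (A : ℝ) (j : Fin m) : Continuous (cellBump A j) := by
  have := unitBump.continuous
  unfold cellBump
  fun_prop

theorem le_bumpFun (l : ℝ) {A : ℝ} (hA : 0 ≤ A) (s : Finset (Fin m)) (x : ℝ) :
    l ≤ bumpFun l A s x :=
  le_add_of_nonneg_right (mul_nonneg hA (bumpTrain_mem_Icc s _).1)

theorem cellBump_mem_Icc {A : ℝ} (hA : 0 ≤ A) (j : Fin m) (x : ℝ) : cellBump A j x ∈ Icc 0 A :=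
  ⟨mul_nonneg hA unitBump.nonneg, mul_le_of_le_one_right hA unitBump.le_one⟩

theorem sum_cellBump_le {A : ℝ} (hA : 0 ≤ A) (x : ℝ) : ∑ j : Fin m, cellBump A j x ≤ A := by
  simp only [cellBump, ← Finset.mul_sum]
  exact mul_le_of_le_one_right hA (bumpTrain_mem_Icc Finset.univ _).2

theorem exists_bumpFun_mem_holderClass {α L : ℝ} (hα : 0 ≤ α) (hL : 0 < L) :
    ∃ a₀ : ℝ, 0 < a₀ ∧ ∀ l u a : ℝ, 0 ≤ a → a ≤ a₀ → a ≤ u - l → ∀ m : ℕ, 0 < m →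
      ∀ s : Finset (Fin m), bumpFun l (a * (m : ℝ) ^ (-α)) s ∈ holderClass α L l u := by
  obtain ⟨B, hB⟩ := exists_abs_iteratedDeriv_unitBump_le ⌊α⌋₊
  obtain ⟨B', hB'⟩ := exists_abs_iteratedDeriv_unitBump_le (⌊α⌋₊ + 1)
  refine ⟨L / (max (2 * B) B' + 1), by positivity, fun l u a ha ha₀ hau m hm s => ?_⟩
  refine dilation_mem_holderClass (contDiff_bumpTrain s) hα (abs_iteratedDeriv_bumpTrain_le hB s)
    (abs_iteratedDeriv_bumpTrain_le hB' s) (bumpTrain_mem_Icc s) ha (by exact_mod_cast hm) ?_ hau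
  calc a * max (2 * B) B' ≤ a * (max (2 * B) B' + 1) := by gcongr; linarith
    _ ≤ L := (le_div_iff₀ (by positivity)).1 ha₀

/-- The cell with index `j` of the partition of `(0, 1]` into `m` intervals of equal length. -/
def gridCell (j : Fin m) : Set ℝ :=
  Ioc ((j : ℝ) / m) (((j : ℝ) + 1) / m)

theorem measurableSet_gridCell (j : Fin m) : MeasurableSet (gridCell j) :=
  measurableSet_Ioc

theorem mem_gridCell_iff {j : Fin m} {x : ℝ} :
    x ∈ gridCell j ↔ (j : ℝ) < m * x ∧ m * x ≤ j + 1 := by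
  have hm : (0 : ℝ) < m := by exact_mod_cast j.pos
  rw [gridCell, mem_Ioc, div_lt_iff₀ hm, le_div_iff₀ hm, mul_comm x]

theorem gridCell_subset_Icc (j : Fin m) : gridCell j ⊆ Icc 0 1 := fun x hx => by
  have hj : ((j : ℕ) : ℝ) + 1 ≤ m := by exact_mod_cast j.2
  have hm : (0 : ℝ) < m := by exact_mod_cast j.pos
  exact ⟨hx.1.le.trans' (by positivity), hx.2.trans ((div_le_one hm).2 hj)⟩

theorem pairwise_disjoint_gridCell : Pairwise (Function.onFun Disjoint (gridCell (m := m))) := by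
  refine fun i j hij => disjoint_left.2 fun x hi hj => hij (Fin.ext ?_)
  rw [mem_gridCell_iff] at hi hj
  have hij' : ((i : ℕ) : ℝ) < (j : ℕ) + 1 := hi.1.trans_le hj.2
  have hji' : ((j : ℕ) : ℝ) < (i : ℕ) + 1 := hj.1.trans_le hi.2
  norm_cast at hij' hji'
  lia

theorem sum_setLIntegral_gridCell_le (f : ℝ → ℝ≥0∞) :
    ∑ j : Fin m, ∫⁻ t in gridCell j, f t ≤ ∫⁻ t in Icc 0 1, f t := by
  rw [← tsum_fintype (L := SummationFilter.unconditional _),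
    ← lintegral_iUnion measurableSet_gridCell pairwise_disjoint_gridCell]
  exact lintegral_mono_set (iUnion_subset gridCell_subset_Icc)

theorem cellBump_eq {A : ℝ} {j : Fin m} {x : ℝ}
    (hx : x ∈ Ioc (((j : ℝ) + 3 / 8) / m) (((j : ℝ) + 5 / 8) / m)) : cellBump A j x = A := by
  have hm : (0 : ℝ) < m := by exact_mod_cast j.pos
  have hx₁ := (div_lt_iff₀ hm).1 hx.1
  have hx₂ := (le_div_iff₀ hm).1 hx.2
  rw [cellBump, unitBump.one_of_mem_closedBall, mul_one]
  rw [Real.closedBall_eq_Icc]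
  constructor <;> simp only [unitBump] <;> linarith

theorem ofReal_le_setLIntegral_cellBump_sq (A c : ℝ) (j : Fin m) :
    ENNReal.ofReal (A ^ 2 / (8 * m) * c) ≤
      ∫⁻ t in gridCell j, ENNReal.ofReal (cellBump A j t ^ 2 / 2 * c) := by
  have hm : (0 : ℝ) < m := by exact_mod_cast j.pos
  have plateau : Ioc (((j : ℝ) + 3 / 8) / m) (((j : ℝ) + 5 / 8) / m) ⊆ gridCell j := by
    apply Ioc_subset_Ioc <;> gcongr <;> linarith
  calc ENNReal.ofReal (A ^ 2 / (8 * m) * c)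
      = ∫⁻ _ in Ioc (((j : ℝ) + 3 / 8) / m) (((j : ℝ) + 5 / 8) / m),
          ENNReal.ofReal (A ^ 2 / 2 * c) := by
        rw [setLIntegral_const, Real.volume_Ioc,
          ← ENNReal.ofReal_mul' (by rw [sub_nonneg]; gcongr; norm_num)]
        congr 1
        field
    _ = ∫⁻ t in Ioc (((j : ℝ) + 3 / 8) / m) (((j : ℝ) + 5 / 8) / m),
          ENNReal.ofReal (cellBump A j t ^ 2 / 2 * c) :=
        setLIntegral_congr_fun measurableSet_Ioc fun t ht => by simp only [cellBump_eq ht]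
    _ ≤ _ := lintegral_mono_set plateau

end Bumps

section Assouad

variable {ι : Type*} [Fintype ι] [DecidableEq ι]

theorem sum_finset_eq_sum_pairs {M : Type*} [AddCommMonoid M] (F : Finset ι → M) (j : ι) :
    ∑ s, F s = ∑ s with j ∉ s, (F s + F (insert j s)) := by
  rw [← Finset.sum_filter_add_sum_filter_not Finset.univ fun s : Finset ι => j ∉ s,
    Finset.sum_add_distrib]
  congr 1
  refine (Finset.sum_nbij' (insert j) (Finset.erase · j) ?_ ?_ (fun s hs => ?_)
    (fun s hs => ?_) ?_).symm
  · simp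
  · simp
  · exact Finset.erase_insert (by simpa using hs)
  · exact Finset.insert_erase (by simpa using hs)
  · simp

theorem assouad {ρ q : Finset ι → ι → ℝ≥0∞} {b R Q : ℝ≥0∞}
    (hpair : ∀ s, ∀ j ∉ s, b ≤ ρ s j + ρ (insert j s) j + q s j)
    (hρ : ∀ s, ∑ j, ρ s j ≤ R) (hq : ∀ s, ∑ j, q s j ≤ Q) :
    Fintype.card ι * b ≤ 2 * (R + Q) := by
  have coordinate (j : ι) : ∑ _s : Finset ι, b ≤ 2 * ∑ s, (ρ s j + q s j) :=
    calc ∑ _s : Finset ι, b = 2 * ∑ s : Finset ι with j ∉ s, b := by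
          rw [sum_finset_eq_sum_pairs _ j, Finset.mul_sum]
          simp only [two_mul]
      _ ≤ 2 * ∑ s : Finset ι with j ∉ s,
            (ρ s j + q s j + (ρ (insert j s) j + q (insert j s) j)) := by
          gcongr with s hs
          refine (hpair s j (Finset.mem_filter.1 hs).2).trans ?_
          rw [add_right_comm, ← add_assoc]
          exact le_self_add
      _ = 2 * ∑ s, (ρ s j + q s j) := by rw [← sum_finset_eq_sum_pairs fun s => ρ s j + q s j]
  refine (ENNReal.mul_le_mul_iff_right (a := Fintype.card (Finset ι)) (by simp) (by simp)).1 ?_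
  calc (Fintype.card (Finset ι) : ℝ≥0∞) * (Fintype.card ι * b) = ∑ _j : ι, ∑ _s : Finset ι, b := by
        simp only [Finset.sum_const, Finset.card_univ, nsmul_eq_mul, mul_left_comm]
    _ ≤ ∑ j, 2 * ∑ s, (ρ s j + q s j) := Finset.sum_le_sum fun j _ => coordinate j
    _ = 2 * ∑ s, (∑ j, ρ s j + ∑ j, q s j) := by
        simp only [← Finset.mul_sum, ← Finset.sum_add_distrib]
        rw [Finset.sum_comm]
    _ ≤ 2 * ∑ _s : Finset ι, (R + Q) := by
        gcongr with s
        exacts [hρ s, hq s]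
    _ = _ := by
        rw [Finset.sum_const, Finset.card_univ, nsmul_eq_mul, mul_left_comm]

end Assouad

section Minimax

open Matrix

theorem trace_observationCov_inv_mul_nonneg {τ : ℝ} (hτ : τ ≠ 0) (n : ℕ) {v h : ℝ → ℝ}
    (hv : ContinuousOn v (Icc 0 1)) (hv0 : ∀ s ∈ Icc (0 : ℝ) 1, 0 ≤ v s)
    (hh : ContinuousOn h (Icc 0 1)) (hh0 : ∀ s ∈ Icc (0 : ℝ) 1, 0 ≤ h s) :
    0 ≤ ((observationCov τ n v)⁻¹ * weightedGram (fun i => ramp (observationTime n i)) h).trace :=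
  trace_mul_nonneg_of_posSemidef (posDef_observationCov hτ hv hv0).inv.posSemidef
    (posSemidef_weightedGram (fun _ => continuous_ramp _) hh hh0)

theorem trace_observationCov_inv_mul_le {τ : ℝ} (hτ : τ ≠ 0) {n : ℕ} (hn : 0 < n) {v h : ℝ → ℝ}
    (hv : ContinuousOn v (Icc 0 1)) {l δ : ℝ} (hl : 0 < l) (hvl : ∀ s ∈ Icc (0 : ℝ) 1, l ≤ v s)
    (hh : ContinuousOn h (Icc 0 1)) (hδ : 0 ≤ δ) (hhδ : ∀ s ∈ Icc (0 : ℝ) 1, h s ≤ δ) :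
    ((observationCov τ n v)⁻¹ * weightedGram (fun i => ramp (observationTime n i)) h).trace ≤
      δ * ((4 / l + (τ ^ 2)⁻¹) * (n : ℝ) ^ (1 / 4 : ℝ)) := by
  have : Nonempty (Fin n) := ⟨⟨0, hn⟩⟩
  simpa only [observationCov, Fintype.card_fin] using trace_inv_mul_weightedGram_ramp_le_rpow
    (fun i => Ioc_subset_Icc_self (observationTime_mem_Ioc i)) hv hl hvl hh hδ hhδ
    (sq_pos_of_ne_zero hτ)

variable {Ω : Type*} [MeasurableSpace Ω] {P : Measure Ω} {W : ℝ≥0 → Ω → ℝ}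
  {ε : (n : ℕ) → Fin n → Ω → ℝ} {X : (ℝ → ℝ) → ℝ≥0 → Ω → ℝ} {τ : ℝ} {n : ℕ}
  {est : (Fin n → ℝ) → ℝ → ℝ}

/-- The expected squared error at the point `t` of the estimator `est` under the squared
volatility `v`; the `L²` risk is its integral over `[0, 1]`. -/
noncomputable def pointwiseRisk (P : Measure Ω) (τ : ℝ) (n : ℕ) (e : Fin n → Ω → ℝ)
    (X : (ℝ → ℝ) → ℝ≥0 → Ω → ℝ) (est : (Fin n → ℝ) → ℝ → ℝ) (v : ℝ → ℝ) (t : ℝ) : ℝ≥0∞ :=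
  ∫⁻ ω, ENNReal.ofReal
    ((est (integratedObservation τ n (X fun s => √(v s)) e ω) t - v t) ^ 2) ∂P

theorem aemeasurable_ofReal_sq_sub_prod {Y : Ω → Fin n → ℝ} (hY : AEMeasurable Y P)
    (hest : Measurable (Function.uncurry est)) {v : ℝ → ℝ} (hv : Measurable v) (μ : Measure ℝ) :
    AEMeasurable (fun p : Ω × ℝ => ENNReal.ofReal ((est (Y p.1) p.2 - v p.2) ^ 2)) (P.prod μ) :=
  (((hest.comp_aemeasurable (hY.comp_fst.prodMk measurable_snd.aemeasurable)).sub
    (hv.comp measurable_snd).aemeasurable).pow_const 2).ennreal_ofReal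

variable [IsProbabilityMeasure P] {m : ℕ}

theorem IsNoisyVolatilityModel.aemeasurable_pointwiseRisk (hM : IsNoisyVolatilityModel P W ε X)
    (hest : Measurable (Function.uncurry est)) {v : ℝ → ℝ} (hv : Continuous v)
    (hv0 : ∀ s, 0 < v s) (μ : Measure ℝ) [SFinite μ] :
    AEMeasurable (pointwiseRisk P τ n (ε n) X est v) μ :=
  (aemeasurable_ofReal_sq_sub_prod (hM.aemeasurable_observation hv.continuousOn fun s _ => hv0 s)
    hest hv.measurable μ).lintegral_prod_left'

theorem IsNoisyVolatilityModel.lintegral_sqL2Dist (hM : IsNoisyVolatilityModel P W ε X)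
    (hest : Measurable (Function.uncurry est)) {v : ℝ → ℝ} (hv : Continuous v)
    (hv0 : ∀ s, 0 < v s) :
    ∫⁻ ω, sqL2Dist (est (integratedObservation τ n (X fun s => √(v s)) (ε n) ω)) v ∂P =
      ∫⁻ t in Icc 0 1, pointwiseRisk P τ n (ε n) X est v t :=
  lintegral_lintegral_swap (aemeasurable_ofReal_sq_sub_prod
    (hM.aemeasurable_observation hv.continuousOn fun s _ => hv0 s) hest hv.measurable _)

theorem IsNoisyVolatilityModel.two_point_pointwiseRisk (hτ : τ ≠ 0)
    (hM : IsNoisyVolatilityModel P W ε X) (hest : Measurable (Function.uncurry est))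
    {l A : ℝ} (hl : 0 < l) (hA : 0 ≤ A) {s : Finset (Fin m)} {j : Fin m} (hj : j ∉ s) (t : ℝ) :
    ENNReal.ofReal (cellBump A j t ^ 2 / 2 * (1 - A / l / 8 *
        ((observationCov τ n (bumpFun l A s))⁻¹ *
          weightedGram (fun i => ramp (observationTime n i)) (cellBump A j)).trace)) ≤
      pointwiseRisk P τ n (ε n) X est (bumpFun l A s) t +
        pointwiseRisk P τ n (ε n) X est (bumpFun l A (insert j s)) t := by
  have relative_height (x : ℝ) : cellBump A j x ≤ A / l * bumpFun l A s x :=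
    calc cellBump A j x ≤ A / l * l := by
          rw [div_mul_cancel₀ _ hl.ne']
          exact (cellBump_mem_Icc hA j x).2
      _ ≤ A / l * bumpFun l A s x := by
          gcongr
          exact le_bumpFun l hA s x
  have two_point := hM.two_point_observation (n := n) hτ (continuous_bumpFun l A s).continuousOn
    (fun x _ => hl.trans_le (le_bumpFun l hA s x)) (continuous_cellBump A j).continuousOn
    (fun x _ => (cellBump_mem_Icc hA j x).1) (by positivity) (fun x _ => relative_height x)
    (f := fun y => est y t) (hest.comp (measurable_id.prodMk measurable_const))
    (bumpFun l A s t) (bumpFun l A s t + cellBump A j t)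
  rw [sub_add_cancel_left, neg_sq] at two_point
  rwa [bumpFun_insert l A hj]

theorem IsNoisyVolatilityModel.ofReal_le_setLIntegral_gridCell_pointwiseRisk (hτ : τ ≠ 0)
    (hM : IsNoisyVolatilityModel P W ε X) (hest : Measurable (Function.uncurry est))
    {l A : ℝ} (hl : 0 < l) (hA : 0 ≤ A) {s : Finset (Fin m)} {j : Fin m} (hj : j ∉ s) :
    ENNReal.ofReal (A ^ 2 / (8 * m)) ≤
      (∫⁻ t in gridCell j, pointwiseRisk P τ n (ε n) X est (bumpFun l A s) t) +
        (∫⁻ t in gridCell j, pointwiseRisk P τ n (ε n) X est (bumpFun l A (insert j s)) t) +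
        ENNReal.ofReal (A ^ 2 / (8 * m) * (A / l / 8 * ((observationCov τ n (bumpFun l A s))⁻¹ *
          weightedGram (fun i => ramp (observationTime n i)) (cellBump A j)).trace)) := by
  set q := A / l / 8 * ((observationCov τ n (bumpFun l A s))⁻¹ *
    weightedGram (fun i => ramp (observationTime n i)) (cellBump A j)).trace
  have cell := calc ENNReal.ofReal (A ^ 2 / (8 * m) * (1 - q))
      ≤ ∫⁻ t in gridCell j, ENNReal.ofReal (cellBump A j t ^ 2 / 2 * (1 - q)) :=
        ofReal_le_setLIntegral_cellBump_sq A _ j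
    _ ≤ ∫⁻ t in gridCell j, (pointwiseRisk P τ n (ε n) X est (bumpFun l A s) t +
          pointwiseRisk P τ n (ε n) X est (bumpFun l A (insert j s)) t) :=
        lintegral_mono fun t => hM.two_point_pointwiseRisk hτ hest hl hA hj t
    _ = _ := lintegral_add_left' (hM.aemeasurable_pointwiseRisk hest (continuous_bumpFun l A s)
        (fun x => hl.trans_le (le_bumpFun l hA s x)) _) _
  calc ENNReal.ofReal (A ^ 2 / (8 * m))
      = ENNReal.ofReal (A ^ 2 / (8 * m) * (1 - q) + A ^ 2 / (8 * m) * q) := by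
        rw [← mul_add, sub_add_cancel, mul_one]
    _ ≤ ENNReal.ofReal (A ^ 2 / (8 * m) * (1 - q)) + ENNReal.ofReal (A ^ 2 / (8 * m) * q) :=
        ENNReal.ofReal_add_le
    _ ≤ _ := by gcongr

theorem sum_trace_observationCov_inv_mul_cellBump_le (hτ : τ ≠ 0) (hn : 0 < n) {l A : ℝ}
    (hl : 0 < l) (hA : 0 ≤ A) (s : Finset (Fin m)) :
    ∑ j : Fin m, ((observationCov τ n (bumpFun l A s))⁻¹ *
        weightedGram (fun i => ramp (observationTime n i)) (cellBump A j)).trace ≤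
      A * ((4 / l + (τ ^ 2)⁻¹) * (n : ℝ) ^ (1 / 4 : ℝ)) := by
  have hcont (j : Fin m) : ContinuousOn (cellBump A j) (Icc 0 1) :=
    (continuous_cellBump A j).continuousOn
  rw [← trace_sum, ← Matrix.mul_sum, ← weightedGram_sum (fun _ => continuous_ramp _) _
    fun j _ => hcont j]
  exact trace_observationCov_inv_mul_le hτ hn (continuous_bumpFun l A s).continuousOn hl
    (fun t _ => le_bumpFun l hA s t) (continuousOn_finsetSum _ fun j _ => hcont j) hA
    (fun t _ => sum_cellBump_le hA t)

theorem sum_ofReal_trace_observationCov_inv_mul_cellBump_le (hτ : τ ≠ 0) (hn : 0 < n) {l A : ℝ}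
    (hl : 0 < l) (hA : 0 ≤ A) (hm : 0 < m)
    (hAm : A ^ 2 / (8 * l) * ((4 / l + (τ ^ 2)⁻¹) * (n : ℝ) ^ (1 / 4 : ℝ)) ≤ m / 4)
    (s : Finset (Fin m)) :
    ∑ j : Fin m, ENNReal.ofReal (A ^ 2 / (8 * m) * (A / l / 8 *
        ((observationCov τ n (bumpFun l A s))⁻¹ *
          weightedGram (fun i => ramp (observationTime n i)) (cellBump A j)).trace)) ≤
      ENNReal.ofReal (A ^ 2 / 32) := by
  have : (0 : ℝ) < m := by exact_mod_cast hm
  have trace_nonneg (j : Fin m) := trace_observationCov_inv_mul_nonneg hτ n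
    (continuous_bumpFun l A s).continuousOn (fun t _ => hl.le.trans (le_bumpFun l hA s t))
    (continuous_cellBump A j).continuousOn (fun t _ => (cellBump_mem_Icc hA j t).1)
  rw [← ENNReal.ofReal_sum_of_nonneg fun j _ => mul_nonneg (by positivity)
    (mul_nonneg (by positivity) (trace_nonneg j)), ← Finset.mul_sum, ← Finset.mul_sum]
  refine ENNReal.ofReal_le_ofReal ?_
  calc _ ≤ A ^ 2 / (8 * m) * (A / l / 8 * (A * ((4 / l + (τ ^ 2)⁻¹) * (n : ℝ) ^ (1 / 4 : ℝ)))) := by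
        gcongr
        exact sum_trace_observationCov_inv_mul_cellBump_le hτ hn hl hA s
    _ = A ^ 2 / (8 * m) * (A ^ 2 / (8 * l) * ((4 / l + (τ ^ 2)⁻¹) * (n : ℝ) ^ (1 / 4 : ℝ))) := by
        ring
    _ ≤ A ^ 2 / (8 * m) * (m / 4) := by gcongr
    _ = A ^ 2 / 32 := by field

theorem IsNoisyVolatilityModel.ofReal_le_iSup_lintegral_pointwiseRisk (hτ : τ ≠ 0) (hn : 0 < n)
    (hM : IsNoisyVolatilityModel P W ε X) (hest : Measurable (Function.uncurry est))
    {l A : ℝ} (hl : 0 < l) (hA : 0 ≤ A) (hm : 0 < m)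
    (hAm : A ^ 2 / (8 * l) * ((4 / l + (τ ^ 2)⁻¹) * (n : ℝ) ^ (1 / 4 : ℝ)) ≤ m / 4) :
    ENNReal.ofReal (A ^ 2 / 32) ≤ ⨆ s : Finset (Fin m),
      ∫⁻ t in Icc 0 1, pointwiseRisk P τ n (ε n) X est (bumpFun l A s) t := by
  have : (0 : ℝ) < m := by exact_mod_cast hm
  set risk : Finset (Fin m) → ℝ → ℝ≥0∞ := fun s =>
    pointwiseRisk P τ n (ε n) X est (bumpFun l A s)
  have separation := assouad (ρ := fun s j => ∫⁻ t in gridCell j, risk s t)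
    (R := ⨆ s, ∫⁻ t in Icc 0 1, risk s t)
    (fun _ _ hj => hM.ofReal_le_setLIntegral_gridCell_pointwiseRisk hτ hest hl hA hj)
    (fun s => (sum_setLIntegral_gridCell_le _).trans
      (le_iSup (fun s => ∫⁻ t in Icc 0 1, risk s t) s))
    (sum_ofReal_trace_observationCov_inv_mul_cellBump_le hτ hn hl hA hm hAm)
  have total : (m : ℝ≥0∞) * ENNReal.ofReal (A ^ 2 / (8 * m)) =
      2 * (ENNReal.ofReal (A ^ 2 / 32) + ENNReal.ofReal (A ^ 2 / 32)) := by
    rw [← two_mul, ← ENNReal.ofReal_natCast, ← ENNReal.ofReal_ofNat 2,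
      ← ENNReal.ofReal_mul (by positivity), ← ENNReal.ofReal_mul (by positivity),
      ← ENNReal.ofReal_mul (by positivity)]
    congr 1
    field
  rw [Fintype.card_fin, total, ENNReal.mul_le_mul_iff_right (by simp) (by simp)] at separation
  exact (ENNReal.add_le_add_iff_right ENNReal.ofReal_ne_top).1 separation

theorem IsNoisyVolatilityModel.ofReal_le_minimaxRiskFun (hτ : τ ≠ 0) (hn : 0 < n)
    (hM : IsNoisyVolatilityModel P W ε X) {V : Set (ℝ → ℝ)} {l A r : ℝ} (hl : 0 < l)
    (hA : 0 ≤ A) (hr : 0 ≤ r) (hm : 0 < m) (hV : ∀ s : Finset (Fin m), bumpFun l A s ∈ V)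
    (hAm : A ^ 2 / (8 * l) * ((4 / l + (τ ^ 2)⁻¹) * (n : ℝ) ^ (1 / 4 : ℝ)) ≤ m / 4) :
    ENNReal.ofReal (r * (A ^ 2 / 32)) ≤ minimaxRiskFun P τ n (ε n) X V r := by
  refine le_iInf₂ fun est hest => ?_
  rw [ENNReal.ofReal_mul hr]
  refine (mul_le_mul_right (hM.ofReal_le_iSup_lintegral_pointwiseRisk hτ hn hest hl hA hm hAm)
    _).trans ?_
  rw [ENNReal.mul_iSup]
  refine iSup_le fun s => le_iSup₂_of_le _ (hV s) ?_
  rw [lintegral_const_mul' _ _ ENNReal.ofReal_ne_top, hM.lintegral_sqL2Dist hest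
    (continuous_bumpFun l A s) fun x => hl.trans_le (le_bumpFun l hA s x)]

theorem IsNoisyVolatilityModel.two_point_const (hτ : τ ≠ 0) (hn : 0 < n)
    (hM : IsNoisyVolatilityModel P W ε X) {f : (Fin n → ℝ) → ℝ} (hf : Measurable f) {l h : ℝ}
    (hl : 0 < l) (hh : 0 ≤ h)
    (hhn : h ^ 2 / (8 * l) * ((4 / l + (τ ^ 2)⁻¹) * (n : ℝ) ^ (1 / 4 : ℝ)) ≤ 1 / 2) :
    ENNReal.ofReal (h ^ 2 / 4) ≤
      ∫⁻ ω, ENNReal.ofReal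
        ((f (integratedObservation τ n (X fun _ => √l) (ε n) ω) - l) ^ 2) ∂P +
      ∫⁻ ω, ENNReal.ofReal
        ((f (integratedObservation τ n (X fun _ => √(l + h)) (ε n) ω) - (l + h)) ^ 2) ∂P := by
  have hc (c : ℝ) : ContinuousOn (fun _ => c) (Icc (0 : ℝ) 1) := continuousOn_const
  have trace_le := trace_observationCov_inv_mul_le hτ hn (hc l) hl (fun _ _ => le_rfl) (hc h) hh
    (fun _ _ => le_rfl)
  have information_le := calc
    h / l / 8 * ((observationCov τ n fun _ => l)⁻¹ *
        weightedGram (fun i => ramp (observationTime n i)) fun _ => h).trace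
      ≤ h / l / 8 * (h * ((4 / l + (τ ^ 2)⁻¹) * (n : ℝ) ^ (1 / 4 : ℝ))) := by gcongr
    _ = h ^ 2 / (8 * l) * ((4 / l + (τ ^ 2)⁻¹) * (n : ℝ) ^ (1 / 4 : ℝ)) := by ring
    _ ≤ 1 / 2 := hhn
  have two_point := hM.two_point_observation hτ (hc l) (fun _ _ => hl) (hc h) (fun _ _ => hh)
    (div_nonneg hh hl.le) (fun _ _ => (div_mul_cancel₀ h hl.ne').ge) hf l (l + h)
  refine (ENNReal.ofReal_le_ofReal ?_).trans two_point
  rw [sub_add_cancel_left, neg_sq]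
  nlinarith [sq_nonneg h]

theorem IsNoisyVolatilityModel.ofReal_le_minimaxRiskConst (hτ : τ ≠ 0) (hn : 0 < n)
    (hM : IsNoisyVolatilityModel P W ε X) {V : Set ℝ} {l h r : ℝ} (hl : 0 < l) (hh : 0 ≤ h)
    (hr : 0 ≤ r) (hlV : l ∈ V) (hhV : l + h ∈ V)
    (hhn : h ^ 2 / (8 * l) * ((4 / l + (τ ^ 2)⁻¹) * (n : ℝ) ^ (1 / 4 : ℝ)) ≤ 1 / 2) :
    ENNReal.ofReal (r * (h ^ 2 / 8)) ≤ minimaxRiskConst P τ n (ε n) X V r := by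
  refine le_iInf₂ fun est hest => ?_
  simp only [ENNReal.ofReal_mul hr, lintegral_const_mul' _ _ ENNReal.ofReal_ne_top]
  set risk : ℝ → ℝ≥0∞ := fun v => ENNReal.ofReal r * ∫⁻ ω, ENNReal.ofReal
    ((est (integratedObservation τ n (X fun _ => √v) (ε n) ω) - v) ^ 2) ∂P
  have risk_le {v : ℝ} (hv : v ∈ V) : risk v ≤ ⨆ v ∈ V, risk v :=
    le_iSup₂ (f := fun v _ => risk v) v hv
  rw [← ENNReal.mul_le_mul_iff_right (a := 2) (by simp) (by simp)]
  calc 2 * (ENNReal.ofReal r * ENNReal.ofReal (h ^ 2 / 8))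
      = ENNReal.ofReal r * ENNReal.ofReal (h ^ 2 / 4) := by
        rw [mul_left_comm, ← ENNReal.ofReal_ofNat 2, ← ENNReal.ofReal_mul zero_le_two]
        congr 2
        ring
    _ ≤ risk l + risk (l + h) := by
        rw [← mul_add]
        exact mul_le_mul_right (hM.two_point_const hτ hn hest hl hh hhn) _
    _ ≤ 2 * ⨆ v ∈ V, risk v := by
        rw [two_mul]
        exact add_le_add (risk_le hlV) (risk_le hhV)

end Minimax

section Rates

theorem exists_height {c C l : ℝ} (hc : 0 < c) (hC : 0 < C) (hl : 0 < l) :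
    ∃ a, 0 < a ∧ a ≤ c ∧ a ^ 2 / (8 * l) * C ≤ 1 / 4 := by
  refine ⟨min c √(2 * l / C), by positivity, min_le_left _ _, ?_⟩
  calc min c √(2 * l / C) ^ 2 / (8 * l) * C ≤ √(2 * l / C) ^ 2 / (8 * l) * C := by
        gcongr
        exact min_le_right _ _
    _ = 1 / 4 := by
        rw [Real.sq_sqrt (by positivity)]
        field

theorem mul_rpow_sq {x : ℝ} (hx : 0 ≤ x) (a y : ℝ) : (a * x ^ y) ^ 2 = a ^ 2 * x ^ (2 * y) := by
  rw [mul_pow, ← Real.rpow_mul_natCast hx, Nat.cast_ofNat, mul_comm y]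

/-- The grid size balancing the two requirements is `m ≈ n ^ (1 / (8 * α + 4))`. -/
theorem exists_grid_size {α : ℝ} (hα : 0 ≤ α) {n : ℕ} (hn : 0 < n) :
    ∃ m : ℕ, 0 < m ∧ (n : ℝ) ^ (1 / 4 : ℝ) ≤ (m : ℝ) ^ (2 * α + 1) ∧
      (2 : ℝ) ^ (2 * -α) ≤ (n : ℝ) ^ (α / (4 * α + 2)) * (m : ℝ) ^ (2 * -α) := by
  have hn0 : (0 : ℝ) < n := by exact_mod_cast hn
  set x : ℝ := (n : ℝ) ^ (1 / (8 * α + 4))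
  have hx : 1 ≤ x := Real.one_le_rpow (by exact_mod_cast hn) (by positivity)
  have hm : (0 : ℝ) < ⌈x⌉₊ := by positivity
  have ceil_le : (⌈x⌉₊ : ℝ) ≤ 2 * x := by linarith [Nat.ceil_lt_add_one (zero_le_one.trans hx)]
  refine ⟨⌈x⌉₊, by exact_mod_cast hm, ?_, ?_⟩
  · calc (n : ℝ) ^ (1 / 4 : ℝ) = x ^ (2 * α + 1) := by
          rw [← Real.rpow_mul hn0.le]
          congr 1
          field
      _ ≤ (⌈x⌉₊ : ℝ) ^ (2 * α + 1) := by
          gcongr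
          exact Nat.le_ceil x
  · calc (2 : ℝ) ^ (2 * -α) = (n : ℝ) ^ (α / (4 * α + 2)) * (2 * x) ^ (2 * -α) := by
          rw [Real.mul_rpow zero_le_two (by positivity), mul_left_comm, ← Real.rpow_mul hn0.le,
            ← Real.rpow_add hn0, show α / (4 * α + 2) + 1 / (8 * α + 4) * (2 * -α) = 0 by field,
            Real.rpow_zero, mul_one]
      _ ≤ _ := mul_le_mul_of_nonneg_left
          (Real.rpow_le_rpow_of_nonpos hm ceil_le (by linarith)) (by positivity)

end Rates

theorem exists_ofReal_le_minimaxRiskFun_holderClass {τ α L l u : ℝ} (hτ : τ ≠ 0) (hα : 0 ≤ α)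
    (hL : 0 < L) (hl : 0 < l) (hlu : l < u) :
    ∃ C : ℝ, 0 < C ∧
      ∀ (Ω : Type*) [MeasurableSpace Ω] (P : Measure Ω) [IsProbabilityMeasure P]
        (W : ℝ≥0 → Ω → ℝ) (ε : (n : ℕ) → Fin n → Ω → ℝ) (X : (ℝ → ℝ) → ℝ≥0 → Ω → ℝ),
        IsNoisyVolatilityModel P W ε X → ∀ n : ℕ, 0 < n →
          ENNReal.ofReal C ≤ minimaxRiskFun P τ n (ε n) X (holderClass α L l u)
            ((n : ℝ) ^ (α / (4 * α + 2))) := by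
  obtain ⟨a₀, ha₀, hmem⟩ := exists_bumpFun_mem_holderClass hα hL
  obtain ⟨a, ha, hac, haC⟩ := exists_height (c := min a₀ (u - l)) (C := 4 / l + (τ ^ 2)⁻¹)
    (lt_min ha₀ (sub_pos.2 hlu)) (by positivity) hl
  refine ⟨a ^ 2 * 2 ^ (2 * -α) / 32, by positivity, fun Ω _ P _ W ε X hM n hn => ?_⟩
  obtain ⟨m, hm, hnm, hrate⟩ := exists_grid_size hα hn
  have hm0 : (0 : ℝ) < m := by exact_mod_cast hm
  have height_sq := mul_rpow_sq hm0.le a (-α)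
  have indistinguishable := calc
    (a * (m : ℝ) ^ (-α)) ^ 2 / (8 * l) * ((4 / l + (τ ^ 2)⁻¹) * (n : ℝ) ^ (1 / 4 : ℝ))
      ≤ a ^ 2 * (m : ℝ) ^ (2 * -α) / (8 * l) * ((4 / l + (τ ^ 2)⁻¹) * (m : ℝ) ^ (2 * α + 1)) := by
        rw [height_sq]
        gcongr
    _ = a ^ 2 / (8 * l) * (4 / l + (τ ^ 2)⁻¹) * ((m : ℝ) ^ (2 * -α) * (m : ℝ) ^ (2 * α + 1)) := by
        ring
    _ ≤ 1 / 4 * ((m : ℝ) ^ (2 * -α) * (m : ℝ) ^ (2 * α + 1)) := by gcongr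
    _ = m / 4 := by
        rw [← Real.rpow_add hm0, show 2 * -α + (2 * α + 1) = 1 by ring, Real.rpow_one]
        ring
  refine (ENNReal.ofReal_le_ofReal ?_).trans (hM.ofReal_le_minimaxRiskFun hτ hn hl
    (by positivity) (by positivity) hm (hmem l u a ha.le (hac.trans (min_le_left _ _))
      (hac.trans (min_le_right _ _)) m hm) indistinguishable)
  rw [height_sq, ← mul_div_assoc, mul_left_comm]
  gcongr

theorem exists_ofReal_le_minimaxRiskConst_Icc {τ σmin σmax : ℝ} (hτ : τ ≠ 0) (hmin : 0 < σmin)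
    (hmax : σmin < σmax) :
    ∃ C : ℝ, 0 < C ∧
      ∀ (Ω : Type*) [MeasurableSpace Ω] (P : Measure Ω) [IsProbabilityMeasure P]
        (W : ℝ≥0 → Ω → ℝ) (ε : (n : ℕ) → Fin n → Ω → ℝ) (X : (ℝ → ℝ) → ℝ≥0 → Ω → ℝ),
        IsNoisyVolatilityModel P W ε X → ∀ n : ℕ, 0 < n →
          ENNReal.ofReal C ≤ minimaxRiskConst P τ n (ε n) X (Icc σmin σmax)
            ((n : ℝ) ^ (1 / 4 : ℝ)) := by
  obtain ⟨a, ha, hac, haC⟩ := exists_height (c := σmax - σmin) (C := 4 / σmin + (τ ^ 2)⁻¹)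
    (sub_pos.2 hmax) (by positivity) hmin
  refine ⟨a ^ 2 / 8, by positivity, fun Ω _ P _ W ε X hM n hn => ?_⟩
  have hn0 : (0 : ℝ) < n := by exact_mod_cast hn
  set h : ℝ := a * (n : ℝ) ^ (-(1 / 8) : ℝ) with hh
  have h_nonneg : 0 ≤ h := by positivity
  have h_le : h ≤ a := mul_le_of_le_one_right ha.le
    (Real.rpow_le_one_of_one_le_of_nonpos (by exact_mod_cast hn) (by norm_num))
  have scaled_sq : (n : ℝ) ^ (1 / 4 : ℝ) * h ^ 2 = a ^ 2 := by
    rw [hh, mul_rpow_sq hn0.le, mul_left_comm, ← Real.rpow_add hn0]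
    norm_num
  have indistinguishable := calc
    h ^ 2 / (8 * σmin) * ((4 / σmin + (τ ^ 2)⁻¹) * (n : ℝ) ^ (1 / 4 : ℝ))
      = (n : ℝ) ^ (1 / 4 : ℝ) * h ^ 2 / (8 * σmin) * (4 / σmin + (τ ^ 2)⁻¹) := by ring
    _ ≤ 1 / 2 := by rw [scaled_sq]; linarith
  rw [← scaled_sq, mul_div_assoc]
  exact hM.ofReal_le_minimaxRiskConst hτ hn hmin h_nonneg (by positivity) ⟨le_rfl, hmax.le⟩
    ⟨by linarith, by linarith⟩ indistinguishable

theorem mainTheorem3_general (τ : ℝ) (hτ : τ ≠ 0) :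
    (∀ α L l u : ℝ, 0 ≤ α → 0 < L → 0 < l → l < u →
      ∃ C : ℝ, 0 < C ∧
        ∀ (Ω : Type*) [MeasurableSpace Ω] (P : Measure Ω) [IsProbabilityMeasure P]
          (W : ℝ≥0 → Ω → ℝ) (ε : (n : ℕ) → Fin n → Ω → ℝ) (X : (ℝ → ℝ) → ℝ≥0 → Ω → ℝ),
          IsNoisyVolatilityModel P W ε X → ∀ n : ℕ, 0 < n →
            ENNReal.ofReal C ≤ minimaxRiskFun P τ n (ε n) X (holderClass α L l u)
              ((n : ℝ) ^ (α / (4 * α + 2)))) ∧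
    (∀ σmin σmax : ℝ, 0 < σmin → σmin < σmax →
      ∃ C : ℝ, 0 < C ∧
        ∀ (Ω : Type*) [MeasurableSpace Ω] (P : Measure Ω) [IsProbabilityMeasure P]
          (W : ℝ≥0 → Ω → ℝ) (ε : (n : ℕ) → Fin n → Ω → ℝ) (X : (ℝ → ℝ) → ℝ≥0 → Ω → ℝ),
          IsNoisyVolatilityModel P W ε X → ∀ n : ℕ, 0 < n →
            ENNReal.ofReal C ≤ minimaxRiskConst P τ n (ε n) X (Icc σmin σmax)
              ((n : ℝ) ^ (1 / 4 : ℝ))) :=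
  ⟨fun _ _ _ _ => exists_ofReal_le_minimaxRiskFun_holderClass hτ,
    fun _ _ => exists_ofReal_le_minimaxRiskConst_Icc hτ⟩

theorem mainTheorem3 (τ : ℝ) (hτ : 0 < τ) :
    (∀ α L l u : ℝ, 1 / 2 < α → 0 < L → 0 < l → l < u →
      ∃ C : ℝ, 0 < C ∧
        ∀ (Ω : Type*) [MeasurableSpace Ω] (P : Measure Ω) [IsProbabilityMeasure P]
          (W : ℝ≥0 → Ω → ℝ) (ε : (n : ℕ) → Fin n → Ω → ℝ) (X : (ℝ → ℝ) → ℝ≥0 → Ω → ℝ),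
          IsNoisyVolatilityModel P W ε X →
          ENNReal.ofReal C ≤ liminf (fun n : ℕ =>
            minimaxRiskFun P τ n (ε n) X (holderClass α L l u)
              ((n : ℝ) ^ (α / (4 * α + 2)))) atTop) ∧
    (∀ σmin σmax : ℝ, 0 < σmin → σmin < σmax →
      ∃ C : ℝ, 0 < C ∧
        ∀ (Ω : Type*) [MeasurableSpace Ω] (P : Measure Ω) [IsProbabilityMeasure P]
          (W : ℝ≥0 → Ω → ℝ) (ε : (n : ℕ) → Fin n → Ω → ℝ) (X : (ℝ → ℝ) → ℝ≥0 → Ω → ℝ),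
          IsNoisyVolatilityModel P W ε X →
          ENNReal.ofReal C ≤ liminf (fun n : ℕ =>
            minimaxRiskConst P τ n (ε n) X (Icc σmin σmax)
              ((n : ℝ) ^ (1 / 4 : ℝ))) atTop) := by
  obtain ⟨holder, const⟩ := mainTheorem3_general τ hτ.ne'
  refine ⟨fun α L l u hα hL hl hlu => ?_, fun σmin σmax hmin hmax => ?_⟩
  · obtain ⟨C, hC, risk_ge⟩ := holder α L l u (by linarith) hL hl hlu
    exact ⟨C, hC, fun Ω _ P _ W ε X hM => le_liminf_of_le
      (h := (eventually_gt_atTop 0).mono (risk_ge Ω P W ε X hM))⟩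
  · obtain ⟨C, hC, risk_ge⟩ := const σmin σmax hmin hmax
    exact ⟨C, hC, fun Ω _ P _ W ε X hM => le_liminf_of_le
      (h := (eventually_gt_atTop 0).mono (risk_ge Ω P W ε X hM))⟩
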